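/- Notation. For $w\in\mathbb R^3$ let $\hat w$ be the skew-symmetric $3\times3$ matrix with $\hat w y=w\times y$, and let $\vee$ be the inverse of the hat map. Put $\operatorname{Sym}A=\frac12(A+A^T)$, $\operatorname{Skew}A=\frac12(A-A^T)$. A system $\dot x=f(t,x)$, $t\ge0$, on a finite-dimensional normed space has $0$ as an exponentially stable equilibrium point if $f(t,0)=0$ for all $t\ge 0$ and there are $c,k,\lambda>0$ such that, for all $t_0\ge0$ and all $x_0$ with $\|x_0\|<c$, a solution on $[t_0,\infty)$ with $x(t_0)=x_0$ exists, and every solution with $x(t_0)=x_0$ satisfies $\|x(t)\|\le k\|x_0\|e^{-\lambda(t-t_0)}$ for all $t\ge t_0$ in its interval of existence. Plant. Let $\mathbb I\in\mathbb R^{3\times 3}$ be symmetric positive definite (the moment of inertia) and let $k_{\rm e}>0$. The rigid body system $\dot R=R\hat\Omega$, $\dot\Omega=\mathbb I^{-1}(\mathbb I\Omega\times\Omega)+\mathbb I^{-1}u$ on $\mathrm{SO}(3)\times\mathbb R^3$ is extended to $\mathbb R^{3\times3}\times\mathbb R^3$ by $$\dot R=R\hat\Omega-k_{\rm e}R(R^TR-I),\qquad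 \dot\Omega=\mathbb I^{-1}(\mathbb I\Omega\times\Omega)+\mathbb I^{-1}u .$$ Reference. Let $(R_0,\Omega_0):[0,\infty)\to\mathrm{SO}(3)\times\mathbb R^3$ be a differentiable solution of the rigid body system driven by a control signal $u_0:[0,\infty)\to\mathbb R^3$, with $\Omega_0$ and $u_0$ bounded. Periodicity of $\Omega_0$ is not assumed. Errors. Let $\Delta R=R-R_0(t)$, $\Delta\Omega=\Omega-\Omega_0(t)$, $\Delta u=u-u_0(t)$, $Z=R_0(t)^T\Delta R$, $Z_s=\operatorname{Sym}Z$, $Z_k=\operatorname{Skew}Z$. Observer. Let $$A(t)=\begin{bmatrix}-\hat\Omega_0(t)&I\\0&\mathbb I^{-1}(\widehat{\mathbb I\Omega_0(t)}-\hat\Omega_0(t)\mathbb I)\end{bmatrix},\quad B=\begin{bmatrix}0\\\mathbb I^{-1}\end{bmatrix},\quad C=\begin{bmatrix}I&0\end{bmatrix},\quad L(t)=\begin{bmatrix}L_1(t)\\L_2(t)\end{bmatrix},$$ $$L_1=-\hat\Omega_0+\mathbb I^{-1}(\widehat{\mathbb I\Omega_0}-\hat\Omega_0\mathbb I)+M_1,\qquad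 L_2=-(\hat{\dot\Omega}_0+\dot L_1)+(\hat\Omega_0+L_1)^2-M_1(\hat\Omega_0+L_1)+M_2,$$ where $M_1,M_2$ are arbitrary constant symmetric positive definite $3\times3$ matrices. The observer state $z_{\rm o}=(Z^\vee_{k,\rm est},\Delta\Omega_{\rm est})\in\mathbb R^3\times\mathbb R^3$ obeys $$\dot z_{\rm o}=A(t)z_{\rm o}+B\,\Delta u-L(t)(Cz_{\rm o}-Z_k^\vee).$$ Controller. Let $k_P>0$, let $K_D$ be symmetric positive definite, and let $$u=u_0-(\mathbb I\,\Delta\Omega_{\rm est})\times\Omega_0-(\mathbb I\,\Omega_0)\times\Delta\Omega_{\rm est}-\mathbb I\,(k_PZ^\vee_{k,\rm est}+K_D\,\Delta\Omega_{\rm est}).$$ Theorem. With this controller and this observer, the origin is an exponentially stable equilibrium point of the (nonlinear, time-varying) closed-loop tracking error dynamics of the extended system, both in the variables $(\Delta R,\Delta\Omega,z_{\rm o})$ and in the variables $(Z_s,Z_k^\vee,\Delta\Omega,z_{\rm o})$. -/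

import Mathlib

open Set
open scoped Matrix

attribute [local instance] Matrix.frobeniusNormedAddCommGroup Matrix.frobeniusNormedSpace

noncomputable section

namespace RigidBody

/-- Vectors of `ℝ³`. The norm carried by this type is the maximum norm; exponential stability in a
finite-dimensional space does not depend on the choice of the norm. -/
abbrev Vec3 := Fin 3 → ℝ

/-- Real `3 × 3` matrices, with the Frobenius norm, i.e. the norm of `⟨A, B⟩ = tr (Aᵀ B)`. -/
abbrev Mat3 := Matrix (Fin 3) (Fin 3) ℝ

/-! ### Exponential stability of the equilibrium `0` of a time-varying system -/

/-- The origin is an exponentially stable equilibrium point of `ẋ = f(t, x)`, `t ≥ 0`, with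
constants that do not depend on the initial time. Solutions that start close to `0` exist for all
later times, and every solution that starts close to `0`, on whatever interval `[t₀, T)` it is
defined, obeys the exponential bound. -/
def IsExpStable {E : Type*} [NormedAddCommGroup E] [NormedSpace ℝ E] (f : ℝ → E → E) : Prop :=
  (∀ t : ℝ, 0 ≤ t → f t 0 = 0) ∧
  ∃ c : ℝ, 0 < c ∧ ∃ k : ℝ, 0 < k ∧ ∃ rate : ℝ, 0 < rate ∧
    ∀ t₀ : ℝ, 0 ≤ t₀ → ∀ x₀ : E, ‖x₀‖ < c →
      (∃ x : ℝ → E, x t₀ = x₀ ∧ IsIntegralCurveOn x f (Ici t₀)) ∧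
      (∀ (T : ℝ) (x : ℝ → E), x t₀ = x₀ → IsIntegralCurveOn x f (Ico t₀ T) →
        ∀ t ∈ Ico t₀ T, ‖x t‖ ≤ k * ‖x₀‖ * Real.exp (-rate * (t - t₀)))

/-! ### Hat map, vee map, symmetric and skew-symmetric parts -/

/-- The hat map from `ℝ³` to the skew-symmetric matrices. -/
def hat (w : Vec3) : Mat3 :=
  !![0, -w 2, w 1; w 2, 0, -w 0; -w 1, w 0, 0]

/-- The vee map; on skew-symmetric matrices it is the inverse of the hat map. -/
def vee (S : Mat3) : Vec3 := ![S 2 1, S 0 2, S 1 0]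

theorem vee_hat (w : Vec3) : vee (hat w) = w := by
  ext i; fin_cases i <;> simp [vee, hat]

theorem hat_vee (S : Mat3) (hS : Sᵀ = -S) : hat (vee S) = S := by
  have h : ∀ i j, S j i = -S i j := fun i j => by
    simpa using congrFun (congrFun hS i) j
  ext i j
  fin_cases i <;> fin_cases j <;> simp [vee, hat]
  all_goals first
    | linarith [h 0 0] | linarith [h 1 1] | linarith [h 2 2]
    | linarith [h 0 1] | linarith [h 0 2] | linarith [h 1 2]

theorem hat_mulVec (x y : Vec3) : hat x *ᵥ y = x ⨯₃ y := by
  ext i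
  fin_cases i <;>
    simp [hat, Matrix.mulVec, dotProduct, Fin.sum_univ_three, crossProduct] <;> ring

/-- The space of symmetric `3 × 3` matrices. -/
def SymMat3 : Submodule ℝ Mat3 where
  carrier := {A | Aᵀ = A}
  add_mem' := fun {A B} hA hB => by
    simp only [mem_ofPred_eq, Matrix.transpose_add] at *; rw [hA, hB]
  zero_mem' := by simp
  smul_mem' := fun c A hA => by
    simp only [mem_ofPred_eq, Matrix.transpose_smul] at *; rw [hA]

/-- `Sym A = (A + Aᵀ) / 2`, as an element of the space of symmetric matrices. -/
def symPart (A : Mat3) : SymMat3 :=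
  ⟨(1 / 2 : ℝ) • (A + Aᵀ), by
    change ((1 / 2 : ℝ) • (A + Aᵀ))ᵀ = (1 / 2 : ℝ) • (A + Aᵀ)
    simp [add_comm]⟩

/-- `Skew A = (A - Aᵀ) / 2`. -/
def skewPart (A : Mat3) : Mat3 := (1 / 2 : ℝ) • (A - Aᵀ)

/-! ### The rigid body and its extension to `ℝ^{3×3} × ℝ³` -/

/-- The right-hand side `J⁻¹ (J Ω × Ω) + J⁻¹ u` of the equation of the body angular velocity;
`J` is the moment of inertia matrix. -/
def eulerField (J : Mat3) (Ω u : Vec3) : Vec3 :=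
  J⁻¹ *ᵥ ((J *ᵥ Ω) ⨯₃ Ω) + J⁻¹ *ᵥ u

/-- The right-hand side `R Ω̂ - kₑ R (Rᵀ R - I)` of the equation of `R` in the extended system on
`ℝ^{3×3} × ℝ³`. On `SO(3) × ℝ³` it reduces to `R Ω̂`. -/
def attitudeField (ke : ℝ) (R : Mat3) (Ω : Vec3) : Mat3 :=
  R * hat Ω - ke • (R * (Rᵀ * R - 1))

/-- A bounded reference trajectory `(R₀, Ω₀) : [0, ∞) → SO(3) × ℝ³` of the rigid body system driven
by a bounded control signal `u₀`. (`R₀` is bounded since it takes values in `SO(3)`.) -/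
structure IsReference (J : Mat3) (R₀ : ℝ → Mat3) (Ω₀ u₀ : ℝ → Vec3) : Prop where
  mem_SO3 : ∀ t, 0 ≤ t → (R₀ t)ᵀ * R₀ t = 1 ∧ 0 < (R₀ t).det
  attitude : ∀ t, 0 ≤ t → HasDerivWithinAt R₀ (R₀ t * hat (Ω₀ t)) (Ici 0) t
  velocity : ∀ t, 0 ≤ t → HasDerivWithinAt Ω₀ (eulerField J (Ω₀ t) (u₀ t)) (Ici 0) t
  bounded_velocity : ∃ C : ℝ, ∀ t, 0 ≤ t → ‖Ω₀ t‖ ≤ C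
  bounded_control : ∃ C : ℝ, ∀ t, 0 ≤ t → ‖u₀ t‖ ≤ C

/-! ### Observer gain, observer, controller -/

/-- The lower right block `J⁻¹ ((J Ω₀)^ - Ω̂₀ J)` of the matrix `A(t)` of the linearization. -/
def velocityBlock (J : Mat3) (w : Vec3) : Mat3 :=
  J⁻¹ * (hat (J *ᵥ w) - hat w * J)

/-- `L₁(t) = -Ω̂₀ + J⁻¹ ((J Ω₀)^ - Ω̂₀ J) + M₁`. -/
def gain₁ (J M₁ : Mat3) (Ω₀ : ℝ → Vec3) (t : ℝ) : Mat3 :=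
  -hat (Ω₀ t) + velocityBlock J (Ω₀ t) + M₁

/-- `L₂(t) = -(Ω̂₀' + L₁') + (Ω̂₀ + L₁)² - M₁ (Ω̂₀ + L₁) + M₂`, with time derivatives taken on
`[0, ∞)`. -/
def gain₂ (J M₁ M₂ : Mat3) (Ω₀ : ℝ → Vec3) (t : ℝ) : Mat3 :=
  -(hat (derivWithin Ω₀ (Ici 0) t) + derivWithin (gain₁ J M₁ Ω₀) (Ici 0) t)
    + (hat (Ω₀ t) + gain₁ J M₁ Ω₀ t) ^ 2
    - M₁ * (hat (Ω₀ t) + gain₁ J M₁ Ω₀ t) + M₂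

/-- The data of the design: the moment of inertia `J`, the constant `kₑ` of the extension, the
reference `R₀`, `Ω₀` with its control signal `u₀`, the controller gains `k_P`, `K_D`, and the
matrices `M₁`, `M₂` of the observer gain. -/
structure Design where
  J : Mat3
  ke : ℝ
  R₀ : ℝ → Mat3
  Ω₀ : ℝ → Vec3
  u₀ : ℝ → Vec3
  kP : ℝ
  KD : Mat3
  M₁ : Mat3
  M₂ : Mat3

/-- The control `u` computed from the observer state `z = (Z_{k,est}^∨, ΔΩ_est)`. -/
def Design.control (D : Design) (t : ℝ) (z : Vec3 × Vec3) : Vec3 :=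
  D.u₀ t - (D.J *ᵥ z.2) ⨯₃ D.Ω₀ t - (D.J *ᵥ D.Ω₀ t) ⨯₃ z.2
    - D.J *ᵥ (D.kP • z.1 + D.KD *ᵥ z.2)

/-- The observer `ż = A(t) z + B Δu - L(t) (C z - y)`, where `y` is the measured `Z_k^∨` and
`A = [-Ω̂₀, I; 0, J⁻¹ ((J Ω₀)^ - Ω̂₀ J)]`, `B = [0; J⁻¹]`, `C = [I, 0]`, `L = [L₁; L₂]`. -/
def Design.observerField (D : Design) (t : ℝ) (z : Vec3 × Vec3) (Δu y : Vec3) : Vec3 × Vec3 :=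
  (-(hat (D.Ω₀ t) *ᵥ z.1) + z.2 - gain₁ D.J D.M₁ D.Ω₀ t *ᵥ (z.1 - y),
   velocityBlock D.J (D.Ω₀ t) *ᵥ z.2 + D.J⁻¹ *ᵥ Δu
    - gain₂ D.J D.M₁ D.M₂ D.Ω₀ t *ᵥ (z.1 - y))

/-! ### The closed-loop tracking error dynamics -/

/-- The right-hand side of the closed-loop dynamics of the tracking errors `ΔR = R - R₀`,
`ΔΩ = Ω - Ω₀` of the extended system, together with the observer state `z`. The observer is fed
with `Skew (R₀ᵀ ΔR)^∨`. -/
def Design.errorField (D : Design) (t : ℝ) (s : Mat3 × Vec3 × (Vec3 × Vec3)) :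
    Mat3 × Vec3 × (Vec3 × Vec3) :=
  let ΔR := s.1
  let ΔΩ := s.2.1
  let z := s.2.2
  let u := D.control t z
  (attitudeField D.ke (D.R₀ t + ΔR) (D.Ω₀ t + ΔΩ) - attitudeField D.ke (D.R₀ t) (D.Ω₀ t),
   eulerField D.J (D.Ω₀ t + ΔΩ) u - eulerField D.J (D.Ω₀ t) (D.u₀ t),
   D.observerField t z (u - D.u₀ t) (vee (skewPart ((D.R₀ t)ᵀ * ΔR))))

/-- The same closed-loop dynamics in the variables `Z_s = Sym Z`, `Z_k^∨ = (Skew Z)^∨`, `ΔΩ`, `z`,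
where `Z = R₀ᵀ ΔR`. So `Z' = (R₀')ᵀ ΔR + R₀ᵀ ΔR'` with `R₀' = R₀ Ω̂₀` and `ΔR = R₀ (Z_s + Z_k)`. -/
def Design.errorFieldZ (D : Design) (t : ℝ) (s : SymMat3 × Vec3 × Vec3 × (Vec3 × Vec3)) :
    SymMat3 × Vec3 × Vec3 × (Vec3 × Vec3) :=
  let ΔR := D.R₀ t * ((s.1 : Mat3) + hat s.2.1)
  let F := D.errorField t (ΔR, s.2.2)
  let Z' := (D.R₀ t * hat (D.Ω₀ t))ᵀ * ΔR + (D.R₀ t)ᵀ * F.1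
  (symPart Z', vee (skewPart Z'), F.2)

end RigidBody

end

/-! Everything rests on coordinates in which the loop becomes a cascade. Besides Z = R₀ᵀ ΔR and v =
ΔΩ, take the estimation error e = Z_{k,est}^∨ - Z_k^∨ and w = (ΔΩ_est - ΔΩ) - G e, where G = Ω̂₀ +
L₁. Write V for `velocityBlock D.J`, so that G = V(Ω₀) + M₁. The gains L₁ and L₂ are chosen so that,
to first order, e' = w and w' = -M₂ e - M₁ w: a damped oscillator with constant coefficients,
although Ω₀ varies with time.

To first order, the symmetric part S of Z obeys S' = [S, Ω̂₀] - 2 kₑ S. The commutator is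
trace-orthogonal to S, so S decays by itself. The skew part q obeys q' = -Ω₀ × q + v, while the
feedback gives v' = -k_P q - K_D v plus a forcing that is linear in (e, w). The rotation does not
change |q|², so this too is a damped oscillator.

Each oscillator a' = r + b, b' = -P a - D b has the Lyapunov function a·Pa + b·b + 2ε a·b with ε
small (`exists_lyapunov_secondOrder`). Adding |S|² and giving the estimator part a large weight μ
absorbs the forcing (`coupling_le`). The result is one constant quadratic form that decreases
uniformly over bounded Ω₀ (`Design.exists_lyapunovForm`), so no periodicity is needed.

The exact field differs from its linearization by terms of order two and higher, bounded uniformly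
in time, so the same form proves local exponential stability (`isExpStable_of_linearization`). The
coordinate changes depend only on R₀ and Ω₀ and are bounded with their inverses; hence stability
passes to both sets of variables (`IsExpStable.of_coordinates`). -/

noncomputable section
namespace RigidBody

open Filter Topology Metric
open scoped NNReal

/-! ### Existence, Lyapunov criteria and coordinate changes for time-varying systems -/

section Abstract

variable {E : Type*} [NormedAddCommGroup E] [NormedSpace ℝ E]

/-- A bounded, globally Lipschitz field that is continuous in time has a solution for all later
times. -/
theorem exists_isIntegralCurveOn_Ici [CompleteSpace E] {f : ℝ → E → E} {t₀ : ℝ} {K L : ℝ≥0}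
    (hK : ∀ t, t₀ ≤ t → LipschitzWith K (f t)) (hc : ∀ x, ContinuousOn (f · x) (Ici t₀))
    (hL : ∀ t, t₀ ≤ t → ∀ x, ‖f t x‖ ≤ L) (x₀ : E) :
    ∃ x : ℝ → E, x t₀ = x₀ ∧ IsIntegralCurveOn x f (Ici t₀) := by
  -- The field is bounded by L on the whole space, so a ball of radius L n holds every solution for
  -- time n and Picard–Lindelöf applies on intervals of any length.
  have hloc : ∀ n : ℕ, ∃ x : ℝ → E, x t₀ = x₀ ∧ IsIntegralCurveOn x f (Icc t₀ (t₀ + n)) := by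
    intro n
    have hn : t₀ ≤ t₀ + n := by simp
    have hpl : IsPicardLindelof f (⟨t₀, left_mem_Icc.2 hn⟩ : Icc t₀ (t₀ + n)) x₀ (L * n) 0 L K :=
      { lipschitzOnWith := fun t ht => (hK t ht.1).lipschitzOnWith
        continuousOn := fun x _ => (hc x).mono Icc_subset_Ici_self
        norm_le := fun t ht x _ => hL t ht.1 x
        mul_max_le := by simp }
    exact hpl.exists_eq_forall_mem_Icc_hasDerivWithinAt₀
  choose x hx0 hx using hloc
  have hagree : ∀ m n : ℕ, m ≤ n → EqOn (x m) (x n) (Icc t₀ (t₀ + m)) := by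
    intro m n hmn
    have hsub : Icc t₀ (t₀ + m) ⊆ Icc t₀ (t₀ + n) :=
      Icc_subset_Icc_right (by gcongr)
    have key : ∀ y : ℝ → E, IsIntegralCurveOn y f (Icc t₀ (t₀ + m)) →
        ∀ t ∈ Ico t₀ (t₀ + m), HasDerivWithinAt y (f t (y t)) (Ici t) t := fun y hy t ht =>
      (hy t (Ico_subset_Icc_self ht)).mono_of_mem_nhdsWithin
        (mem_of_superset (Icc_mem_nhdsGE ht.2) (Icc_subset_Icc_left ht.1))
    exact ODE_solution_unique_of_mem_Icc_right (s := fun _ => univ)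
      (fun t ht => (hK t ht.1).lipschitzOnWith)
      (hx m).continuousOn (key _ (hx m)) (fun _ _ => trivial)
      ((hx n).mono hsub).continuousOn (key _ ((hx n).mono hsub)) (fun _ _ => trivial)
      ((hx0 m).trans (hx0 n).symm)
  -- The extra 1 makes t strictly less than t₀ + N t, so the glued curve agrees with a single local
  -- solution near t within `Ici t₀`.
  let N : ℝ → ℕ := fun t => ⌈t - t₀⌉₊ + 1
  have hN : ∀ t, t < t₀ + N t := fun t => by
    have := Nat.le_ceil (t - t₀)
    simp only [N]; push_cast; linarith
  have hglue : ∀ (n : ℕ) (t : ℝ), t ∈ Icc t₀ (t₀ + n) → x (N t) t = x n t := by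
    intro n t ht
    rcases le_total (N t) n with h | h
    · exact hagree _ _ h ⟨ht.1, (hN t).le⟩
    · exact (hagree _ _ h ht).symm
  refine ⟨fun t => x (N t) t, hx0 _, fun t ht => ?_⟩
  have h1 := hx (N t) t ⟨ht, (hN t).le⟩
  have h2 : HasDerivWithinAt (fun t => x (N t) t) (f t (x (N t) t)) (Icc t₀ (t₀ + N t)) t :=
    h1.congr (fun s hs => hglue _ _ hs) rfl
  refine h2.mono_of_mem_nhdsWithin ?_
  rw [← Ici_inter_Iic]
  exact inter_mem_nhdsWithin _ (Iic_mem_nhds (hN t))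

/-- A curve along which a positive definite quadratic form is strictly decreasing near `0`
converges exponentially to `0`. -/
theorem quadratic_decay {g : ℝ → E → E} {B : E →L[ℝ] E →L[ℝ] ℝ} (hsymm : ∀ x y, B x y = B y x)
    {m M r α : ℝ} (hm : 0 < m) (hM : 0 < M) (hα : 0 < α)
    (hmB : ∀ y, m * ‖y‖ ^ 2 ≤ B y y) (hMB : ∀ y, B y y ≤ M * ‖y‖ ^ 2)
    (hr : 0 < r) {t₀ T : ℝ}
    (hdec : ∀ t, t₀ ≤ t → ∀ y, ‖y‖ ≤ r → B y (g t y) ≤ -α * ‖y‖ ^ 2)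
    {x : ℝ → E} (hxc : ContinuousOn x (Icc t₀ T))
    (hx : ∀ t ∈ Ico t₀ T, HasDerivWithinAt x (g t (x t)) (Ici t) t)
    (hsmall : M * ‖x t₀‖ ^ 2 < m * r ^ 2) {t : ℝ} (ht : t ∈ Icc t₀ T) :
    B (x t) (x t) ≤ B (x t₀) (x t₀) * Real.exp (-(α / M) * (t - t₀)) := by
  -- The barrier starts at some W₀ > 0. At a contact time the form is at most m r², so the curve is
  -- in the ball where it decays. Its derivative there is at most -2 (α/M) B, strictly below the
  -- barrier slope -(α/M) B because B = W₀ exp(…) > 0.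
  have main : ∀ W₀ : ℝ, B (x t₀) (x t₀) ≤ W₀ → 0 < W₀ → W₀ ≤ m * r ^ 2 →
      B (x t) (x t) ≤ W₀ * Real.exp (-(α / M) * (t - t₀)) := by
    intro W₀ h0 hpos hle
    refine image_le_of_deriv_right_lt_deriv_boundary (f := fun s => B (x s) (x s))
      (f' := fun s => B (x s) (g s (x s)) + B (g s (x s)) (x s))
      (B := fun s => W₀ * Real.exp (-(α / M) * (s - t₀)))
      (B' := fun s => W₀ * (Real.exp (-(α / M) * (s - t₀)) * (-(α / M) * 1)))
      (a := t₀) (b := T) ?_ ?_ (by simpa using h0) ?_ ?_ ht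
    · exact (B.continuous.comp_continuousOn hxc).clm_apply hxc
    · exact fun s hs => B.hasDerivWithinAt_of_bilinear (hx s hs) (hx s hs)
    · exact fun s =>
        ((((hasDerivAt_id s).sub_const t₀).const_mul (-(α / M))).exp).const_mul W₀
    · intro s hs heq
      have hexp : Real.exp (-(α / M) * (s - t₀)) ≤ 1 := by
        rw [Real.exp_le_one_iff]
        have : 0 ≤ α / M * (s - t₀) := mul_nonneg (by positivity) (by linarith [hs.1])
        linarith
      have hWle : B (x s) (x s) ≤ m * r ^ 2 := by
        rw [heq]; nlinarith
      have hn : ‖x s‖ ≤ r := by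
        have h1 : ‖x s‖ ^ 2 ≤ r ^ 2 := le_of_mul_le_mul_left ((hmB (x s)).trans hWle) hm
        exact (pow_le_pow_iff_left₀ (norm_nonneg _) hr.le two_ne_zero).1 h1
      have hd := hdec s hs.1 (x s) hn
      have hpos' : 0 < B (x s) (x s) := by rw [heq]; positivity
      have h2 : α / M * B (x s) (x s) ≤ α * ‖x s‖ ^ 2 := by
        rw [div_mul_eq_mul_div, div_le_iff₀ hM]
        nlinarith [hMB (x s)]
      have h3 : 0 < α / M * B (x s) (x s) := by positivity
      have h4 : W₀ * (Real.exp (-(α / M) * (s - t₀)) * (-(α / M) * 1))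
          = -(α / M * B (x s) (x s)) := by rw [heq]; ring
      change B (x s) (g s (x s)) + B (g s (x s)) (x s) < _
      rw [h4, hsymm (g s (x s)) (x s)]
      linarith
  have hB0 : B (x t₀) (x t₀) < m * r ^ 2 := (hMB _).trans_lt hsmall
  have hB0' : 0 ≤ B (x t₀) (x t₀) := le_trans (by positivity) (hmB _)
  -- Letting W₀ decrease to the initial value also covers a curve that starts at 0, where no
  -- positive barrier is sharp.
  have hlim : Tendsto (fun W₀ : ℝ => W₀ * Real.exp (-(α / M) * (t - t₀)))
      (𝓝[>] (B (x t₀) (x t₀)))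
      (𝓝 (B (x t₀) (x t₀) * Real.exp (-(α / M) * (t - t₀)))) :=
    ((continuous_mul_const _).tendsto _).mono_left nhdsWithin_le_nhds
  refine ge_of_tendsto hlim ?_
  filter_upwards [Ioc_mem_nhdsGT hB0] with W₀ hW
  exact main W₀ hW.1.le (hB0'.trans_lt hW.1) hW.2

/-- A cutoff of the identity map: bounded, Lipschitz and equal to the identity on a ball. -/
theorem exists_lipschitz_cutoff [FiniteDimensional ℝ E] {r : ℝ} (hr : 0 < r) :
    ∃ (ρ : E → E) (K : ℝ≥0) (M : ℝ), LipschitzWith K ρ ∧ (∀ y, ‖ρ y‖ ≤ M) ∧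
      ∀ y, ‖y‖ ≤ r → ρ y = y := by
  let χ : ContDiffBump (0 : E) := ⟨r, r + 1, hr, by linarith⟩
  have hcd : ContDiff ℝ 1 (fun y : E => χ y • y) := χ.contDiff.smul contDiff_id
  have hcs : HasCompactSupport (fun y : E => χ y • y) := χ.hasCompactSupport.smul_right
  obtain ⟨K, hK⟩ := hcd.lipschitzWith_of_hasCompactSupport hcs one_ne_zero
  obtain ⟨M, hM⟩ := hcs.exists_bound_of_continuous hcd.continuous
  refine ⟨_, K, M, hK, hM, fun y hy => ?_⟩
  rw [χ.one_of_mem_closedBall (by simpa using hy), one_smul]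

/-- Lyapunov's criterion for exponential stability with a quadratic Lyapunov function. -/
theorem isExpStable_of_quadratic_lyapunov [FiniteDimensional ℝ E] {g : ℝ → E → E}
    (hzero : ∀ t, 0 ≤ t → g t 0 = 0)
    (hcont : ∀ y, ContinuousOn (g · y) (Ici 0))
    (hlip : ∀ M : ℝ, ∃ K : ℝ≥0, ∀ t, 0 ≤ t → LipschitzOnWith K (g t) (closedBall 0 M))
    {B : E →L[ℝ] E →L[ℝ] ℝ} (hsymm : ∀ x y, B x y = B y x)
    {m r α : ℝ} (hm : 0 < m) (hr : 0 < r) (hα : 0 < α) (hmB : ∀ y, m * ‖y‖ ^ 2 ≤ B y y)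
    (hdec : ∀ t, 0 ≤ t → ∀ y, ‖y‖ ≤ r → B y (g t y) ≤ -α * ‖y‖ ^ 2) :
    IsExpStable g := by
  have : CompleteSpace E := FiniteDimensional.complete ℝ E
  refine ⟨hzero, ?_⟩
  -- The summand m keeps M positive even on a trivial space.
  set M : ℝ := ‖B‖ + m with hMdef
  have hM : 0 < M := by positivity
  have hMB : ∀ y, B y y ≤ M * ‖y‖ ^ 2 := fun y => by
    have := (Real.le_norm_self _).trans (B.le_opNorm₂ y y)
    nlinarith [sq_nonneg ‖y‖]
  have hkpos : 0 < Real.sqrt (M / m) := Real.sqrt_pos.2 (by positivity)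
  have hsmall : ∀ x₀ : E, ‖x₀‖ < r / Real.sqrt (M / m) → M * ‖x₀‖ ^ 2 < m * r ^ 2 := by
    intro x₀ hx₀
    rw [lt_div_iff₀ hkpos] at hx₀
    have h1 : (‖x₀‖ * Real.sqrt (M / m)) ^ 2 < r ^ 2 :=
      pow_lt_pow_left₀ hx₀ (by positivity) two_ne_zero
    rw [mul_pow, Real.sq_sqrt (by positivity), mul_div_assoc', div_lt_iff₀ hm] at h1
    linarith
  -- The form controls the square of the norm: hence the square root in the constants and the halved
  -- rate.
  refine ⟨r / Real.sqrt (M / m), by positivity, Real.sqrt (M / m), hkpos, α / M / 2,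
    by positivity, fun t₀ ht₀ x₀ hx₀ => ⟨?_, ?_⟩⟩
  -- The truncated field has global solutions, and it equals g on the ball of radius r. The Lyapunov
  -- bound keeps the solution in that ball, where it therefore solves the original equation.
  · obtain ⟨ρ, Kρ, Mρ, hρL, hρM, hρ⟩ := exists_lipschitz_cutoff (E := E) hr
    obtain ⟨K, hK⟩ := hlip Mρ
    have hMρ : 0 ≤ Mρ := (norm_nonneg _).trans (hρM 0)
    have hmem : ∀ y, ρ y ∈ closedBall (0 : E) Mρ := fun y => by simpa using hρM y
    obtain ⟨x, hx0, hx⟩ := exists_isIntegralCurveOn_Ici (f := fun t y => g t (ρ y)) (t₀ := t₀)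
      (K := K * Kρ) (L := K * Mρ.toNNReal)
      (fun t ht => by
        have := (hK t (ht₀.trans ht)).comp (hρL.lipschitzOnWith (s := univ)) (fun y _ => hmem y)
        exact lipschitzOnWith_univ.1 this)
      (fun y => (hcont (ρ y)).mono (Ici_subset_Ici.2 ht₀))
      (fun t ht y => by
        have h := (hK t (ht₀.trans ht)).norm_sub_le (hmem y) (mem_closedBall_self hMρ)
        rw [hzero t (ht₀.trans ht), sub_zero, sub_zero] at h
        refine h.trans ?_
        rw [NNReal.coe_mul, Real.coe_toNNReal _ hMρ]
        exact mul_le_mul_of_nonneg_left (hρM y) K.2) x₀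
    refine ⟨x, hx0, fun t ht => ?_⟩
    have hball : ‖x t‖ ≤ r := by
      have hd := quadratic_decay (g := fun t y => g t (ρ y)) (T := t + 1) hsymm hm hM hα hmB hMB hr
        (fun s hs y hy => by rw [hρ y hy]; exact hdec s (ht₀.trans hs) y hy)
        (x := x) ((hx.mono Icc_subset_Ici_self).continuousOn)
        (fun s hs => (hx s hs.1).mono (Ici_subset_Ici.2 hs.1))
        (by rw [hx0]; exact hsmall x₀ hx₀) (t := t) ⟨ht, by linarith⟩
      have hexp : Real.exp (-(α / M) * (t - t₀)) ≤ 1 := by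
        rw [Real.exp_le_one_iff]
        have : 0 ≤ α / M * (t - t₀) := mul_nonneg (by positivity) (sub_nonneg.2 ht)
        linarith
      have hB0 : 0 ≤ B (x t₀) (x t₀) := le_trans (by positivity) (hmB _)
      have h1 : m * ‖x t‖ ^ 2 ≤ m * r ^ 2 := by
        have := hsmall x₀ hx₀
        rw [← hx0] at this
        nlinarith [hmB (x t), hMB (x t₀)]
      exact (pow_le_pow_iff_left₀ (norm_nonneg _) hr.le two_ne_zero).1
        (le_of_mul_le_mul_left h1 hm)
    have := hx t ht
    simp only [hρ _ hball] at this
    exact this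
  · intro T x hx0 hx t ht
    have hd := quadratic_decay (g := g) (T := t) hsymm hm hM hα hmB hMB hr
      (fun s hs y hy => hdec s (ht₀.trans hs) y hy)
      (x := x) ((hx.mono (Icc_subset_Ico_right ht.2)).continuousOn)
      (fun s hs => (hx s ⟨hs.1, hs.2.trans ht.2⟩).mono_of_mem_nhdsWithin
        (mem_of_superset (Ico_mem_nhdsGE (hs.2.trans ht.2)) (Ico_subset_Ico_left hs.1)))
      (by rw [hx0]; exact hsmall x₀ hx₀) (t := t) ⟨ht.1, le_rfl⟩
    rw [hx0] at hd
    set e := Real.exp (-(α / M / 2) * (t - t₀)) with he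
    have hee : Real.exp (-(α / M) * (t - t₀)) = e ^ 2 := by
      rw [he, ← Real.exp_nat_mul]; congr 1; push_cast; ring
    rw [hee] at hd
    have h1 : m * ‖x t‖ ^ 2 ≤ M * ‖x₀‖ ^ 2 * e ^ 2 :=
      (hmB _).trans (hd.trans (mul_le_mul_of_nonneg_right (hMB x₀) (sq_nonneg _)))
    have h2 : ‖x t‖ ^ 2 ≤ (Real.sqrt (M / m) * ‖x₀‖ * e) ^ 2 := by
      rw [mul_pow, mul_pow, Real.sq_sqrt (by positivity), div_mul_eq_mul_div, div_mul_eq_mul_div,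
        le_div_iff₀ hm]
      linarith
    exact (pow_le_pow_iff_left₀ (norm_nonneg _) (by positivity) two_ne_zero).1 h2

/-- Lyapunov's indirect method: a quadratic Lyapunov function of the linearization shows
exponential stability when the remainder is quadratically small. -/
theorem isExpStable_of_linearization [FiniteDimensional ℝ E] {g A N : ℝ → E → E}
    (hg : ∀ t, 0 ≤ t → ∀ y, g t y = A t y + N t y)
    (hzero : ∀ t, 0 ≤ t → g t 0 = 0)
    (hcont : ∀ y, ContinuousOn (g · y) (Ici 0))
    (hlip : ∀ M : ℝ, ∃ K : ℝ≥0, ∀ t, 0 ≤ t → LipschitzOnWith K (g t) (closedBall 0 M))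
    {B : E →L[ℝ] E →L[ℝ] ℝ} (hsymm : ∀ x y, B x y = B y x)
    {m α β : ℝ} (hm : 0 < m) (hα : 0 < α) (hβ : 0 ≤ β) (hmB : ∀ y, m * ‖y‖ ^ 2 ≤ B y y)
    (hdec : ∀ t, 0 ≤ t → ∀ y, B y (A t y) ≤ -α * ‖y‖ ^ 2)
    (hrem : ∀ t, 0 ≤ t → ∀ y, ‖y‖ ≤ 1 → ‖N t y‖ ≤ β * ‖y‖ ^ 2) :
    IsExpStable g := by
  -- The radius is such that the remainder uses up at most half of the decay α; the 1 in the
  -- denominator guards against ‖B‖ β = 0.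
  refine isExpStable_of_quadratic_lyapunov (r := min 1 (α / 2 / (‖B‖ * β + 1))) (α := α / 2)
    hzero hcont hlip hsymm hm (by positivity) (by positivity) hmB (fun t ht y hy => ?_)
  have hy1 : ‖y‖ ≤ 1 := hy.trans (min_le_left _ _)
  have hy2 : ‖y‖ * (‖B‖ * β + 1) ≤ α / 2 := by
    rw [← le_div_iff₀ (by positivity)]; exact hy.trans (min_le_right _ _)
  have h1 := hdec t ht y
  have h2 : B y (N t y) ≤ α / 2 * ‖y‖ ^ 2 := by
    calc B y (N t y) ≤ ‖B‖ * ‖y‖ * ‖N t y‖ :=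
          (Real.le_norm_self _).trans (B.le_opNorm₂ _ _)
      _ ≤ ‖B‖ * ‖y‖ * (β * ‖y‖ ^ 2) := by
          gcongr; exact hrem t ht y hy1
      _ = (‖y‖ * (‖B‖ * β)) * ‖y‖ ^ 2 := by ring
      _ ≤ α / 2 * ‖y‖ ^ 2 := by
          gcongr
          nlinarith [norm_nonneg y]
  rw [hg t ht, map_add]
  linarith

/-- A `C¹` field is locally Lipschitz, uniformly in a bounded parameter. -/
theorem exists_lipschitzOnWith_closedBall {P : Type*} [NormedAddCommGroup P] [NormedSpace ℝ P]
    [FiniteDimensional ℝ P] [FiniteDimensional ℝ E] {H : P → E → E}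
    (hH : ContDiff ℝ 1 fun q : P × E => H q.1 q.2) (C M : ℝ) :
    ∃ K : ℝ≥0, ∀ p, ‖p‖ ≤ C → LipschitzOnWith K (H p) (closedBall 0 M) := by
  have := FiniteDimensional.proper ℝ P
  have := FiniteDimensional.proper ℝ E
  obtain ⟨K, hK⟩ := hH.contDiffOn.exists_lipschitzOnWith one_ne_zero
    ((convex_closedBall (0 : P) C).prod (convex_closedBall (0 : E) M))
    ((isCompact_closedBall (0 : P) C).prod (isCompact_closedBall (0 : E) M))
  refine ⟨K, fun p hp x hx y hy => ?_⟩
  have hp' : p ∈ closedBall (0 : P) C := by simpa using hp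
  have h := hK (mk_mem_prod hp' hx) (mk_mem_prod hp' hy)
  simpa [Prod.edist_eq] using h

theorem continuousOn_parametrized_field {P : Type*} [NormedAddCommGroup P] [NormedSpace ℝ P]
    {H : P → E → E} (hH : ContDiff ℝ 1 fun q : P × E => H q.1 q.2) {p : ℝ → P} {s : Set ℝ}
    (hp : ContinuousOn p s) (y : E) : ContinuousOn (fun t => H (p t) y) s :=
  hH.continuous.comp_continuousOn (hp.prodMk continuousOn_const)

/-- Exponential stability is invariant under time-varying changes of coordinates that are bounded
together with their inverses. -/
theorem IsExpStable.of_coordinates {F : Type*} [NormedAddCommGroup F] [NormedSpace ℝ F]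
    {f : ℝ → E → E} {g : ℝ → F → F} (hg : IsExpStable g) (hzero : ∀ t, 0 ≤ t → f t 0 = 0)
    {Φ : ℝ → E → F} {Ψ : ℝ → F → E} {C : ℝ}
    (hΨΦ : ∀ t, 0 ≤ t → ∀ x, Ψ t (Φ t x) = x)
    (hΦ : ∀ t, 0 ≤ t → ∀ x, ‖Φ t x‖ ≤ C * ‖x‖) (hΨ : ∀ t, 0 ≤ t → ∀ y, ‖Ψ t y‖ ≤ C * ‖y‖)
    (hpush : ∀ s ⊆ Ici (0 : ℝ), ∀ x : ℝ → E, ∀ t ∈ s, HasDerivWithinAt x (f t (x t)) s t →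
      HasDerivWithinAt (fun τ => Φ τ (x τ)) (g t (Φ t (x t))) s t)
    (hpull : ∀ s ⊆ Ici (0 : ℝ), ∀ y : ℝ → F, ∀ t ∈ s, HasDerivWithinAt y (g t (y t)) s t →
      HasDerivWithinAt (fun τ => Ψ τ (y τ)) (f t (Ψ t (y t))) s t) :
    IsExpStable f := by
  obtain ⟨-, c, hc, k, hk, rate, hrate, H⟩ := hg
  refine ⟨hzero, ?_⟩
  set K : ℝ := max C 1 with hK
  have hK0 : 0 < K := lt_max_of_lt_right one_pos
  have hΦ' : ∀ t, 0 ≤ t → ∀ x, ‖Φ t x‖ ≤ K * ‖x‖ := fun t ht x =>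
    (hΦ t ht x).trans (mul_le_mul_of_nonneg_right (le_max_left _ _) (norm_nonneg _))
  have hΨ' : ∀ t, 0 ≤ t → ∀ x, ‖Ψ t x‖ ≤ K * ‖x‖ := fun t ht x =>
    (hΨ t ht x).trans (mul_le_mul_of_nonneg_right (le_max_left _ _) (norm_nonneg _))
  -- One factor K is the cost of entering the new coordinates, the other that of returning; the rate
  -- is unaffected.
  refine ⟨c / K, by positivity, K * k * K, by positivity, rate, hrate, fun t₀ ht₀ x₀ hx₀ => ?_⟩
  have hsub : ∀ s, s ⊆ Ici t₀ → s ⊆ Ici (0 : ℝ) := fun s hs => hs.trans (Ici_subset_Ici.2 ht₀)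
  have hy₀ : ‖Φ t₀ x₀‖ < c := by
    refine (hΦ' t₀ ht₀ x₀).trans_lt ?_
    rwa [lt_div_iff₀ hK0, mul_comm] at hx₀
  obtain ⟨⟨y, hy0, hy⟩, hbound⟩ := H t₀ ht₀ (Φ t₀ x₀) hy₀
  refine ⟨⟨fun t => Ψ t (y t), by simp only [hy0]; exact hΨΦ t₀ ht₀ x₀,
    fun t ht => hpull _ (hsub _ subset_rfl) y t ht (hy t ht)⟩, fun T x hx0 hx t ht => ?_⟩
  have ht0 : 0 ≤ t := ht₀.trans ht.1
  have hb := hbound T (fun t => Φ t (x t)) (by simp only [hx0])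
    (fun t ht => hpush _ (hsub _ Ico_subset_Ici_self) x t ht (hx t ht)) t ht
  calc ‖x t‖ = ‖Ψ t (Φ t (x t))‖ := by rw [hΨΦ t ht0]
    _ ≤ K * ‖Φ t (x t)‖ := hΨ' t ht0 _
    _ ≤ K * (k * ‖Φ t₀ x₀‖ * Real.exp (-rate * (t - t₀))) := by gcongr
    _ ≤ K * (k * (K * ‖x₀‖) * Real.exp (-rate * (t - t₀))) := by
        gcongr; exact hΦ' t₀ ht₀ x₀
    _ = K * k * K * ‖x₀‖ * Real.exp (-rate * (t - t₀)) := by ring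

end Abstract

/-! ### Matrix operations as continuous linear and bilinear maps -/

/-- Matrix multiplication as a continuous bilinear map. -/
def mulL : Mat3 →L[ℝ] Mat3 →L[ℝ] Mat3 := (LinearMap.mul ℝ Mat3).toContinuousBilinearMap

/-- The matrix-vector product as a continuous bilinear map. -/
def mulVecL : Mat3 →L[ℝ] Vec3 →L[ℝ] Vec3 := (Matrix.mulVecBilin ℝ ℝ).toContinuousBilinearMap

/-- The cross product as a continuous bilinear map. -/
def crossL : Vec3 →L[ℝ] Vec3 →L[ℝ] Vec3 := (crossProduct (R := ℝ)).toContinuousBilinearMap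

/-- The transpose as a continuous linear map. -/
def transposeL : Mat3 →L[ℝ] Mat3 :=
  (Matrix.transposeLinearEquiv (Fin 3) (Fin 3) ℝ ℝ).toLinearMap.toContinuousLinearMap

theorem hat_add (v w : Vec3) : hat (v + w) = hat v + hat w := by
  ext i j; fin_cases i <;> fin_cases j <;> simp [hat] <;> ring

theorem hat_smul (c : ℝ) (v : Vec3) : hat (c • v) = c • hat v := by
  ext i j; fin_cases i <;> fin_cases j <;> simp [hat]

/-- The hat map as a continuous linear map. -/
def hatL : Vec3 →L[ℝ] Mat3 :=
  LinearMap.toContinuousLinearMap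
    { toFun := hat, map_add' := hat_add, map_smul' := hat_smul }

/-- The vector `(Skew Z)^∨`. -/
def skewVec (Z : Mat3) : Vec3 := vee (skewPart Z)

theorem skewVec_add (Z W : Mat3) : skewVec (Z + W) = skewVec Z + skewVec W := by
  ext i; fin_cases i <;> simp [skewVec, vee, skewPart] <;> ring

theorem skewVec_smul (c : ℝ) (Z : Mat3) : skewVec (c • Z) = c • skewVec Z := by
  ext i; fin_cases i <;> simp [skewVec, vee, skewPart] <;> ring

/-- The map `Z ↦ (Skew Z)^∨` as a continuous linear map. -/
def skewVecL : Mat3 →L[ℝ] Vec3 :=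
  LinearMap.toContinuousLinearMap
    { toFun := skewVec, map_add' := skewVec_add, map_smul' := skewVec_smul }

/-- The symmetric part as a continuous linear map. -/
def symPartL : Mat3 →L[ℝ] SymMat3 :=
  LinearMap.toContinuousLinearMap
    { toFun := symPart
      map_add' := fun A B => by
        ext i j; simp [symPart]; ring
      map_smul' := fun c A => by
        ext i j; simp [symPart]; ring }

theorem symPart_add_hat_skewVec (Z : Mat3) : (symPart Z : Mat3) + hat (skewVec Z) = Z := by
  ext i j
  fin_cases i <;> fin_cases j <;> simp [symPart, skewVec, skewPart, vee, hat] <;> ring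

section ContDiff

variable {E : Type*} [NormedAddCommGroup E] [NormedSpace ℝ E] {n : WithTop ℕ∞}

@[fun_prop]
theorem contDiff_matrix_mul {f g : E → Mat3} (hf : ContDiff ℝ n f) (hg : ContDiff ℝ n g) :
    ContDiff ℝ n (fun x => f x * g x) :=
  mulL.isBoundedBilinearMap.contDiff.comp (hf.prodMk hg)

@[fun_prop]
theorem contDiff_matrix_mulVec {f : E → Mat3} {g : E → Vec3} (hf : ContDiff ℝ n f)
    (hg : ContDiff ℝ n g) : ContDiff ℝ n (fun x => f x *ᵥ g x) :=
  mulVecL.isBoundedBilinearMap.contDiff.comp (hf.prodMk hg)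

@[fun_prop]
theorem contDiff_cross {f g : E → Vec3} (hf : ContDiff ℝ n f) (hg : ContDiff ℝ n g) :
    ContDiff ℝ n (fun x => f x ⨯₃ g x) :=
  crossL.isBoundedBilinearMap.contDiff.comp (hf.prodMk hg)

@[fun_prop]
theorem contDiff_hat {f : E → Vec3} (hf : ContDiff ℝ n f) : ContDiff ℝ n (fun x => hat (f x)) :=
  hatL.contDiff.comp hf

@[fun_prop]
theorem contDiff_skewVec {f : E → Mat3} (hf : ContDiff ℝ n f) :
    ContDiff ℝ n (fun x => skewVec (f x)) :=
  skewVecL.contDiff.comp hf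

@[fun_prop]
theorem contDiff_matrix_transpose {f : E → Mat3} (hf : ContDiff ℝ n f) :
    ContDiff ℝ n (fun x => (f x)ᵀ) :=
  transposeL.contDiff.comp hf

@[fun_prop]
theorem contDiff_velocityBlock (J : Mat3) {f : E → Vec3} (hf : ContDiff ℝ n f) :
    ContDiff ℝ n (fun x => velocityBlock J (f x)) := by
  unfold velocityBlock
  fun_prop

end ContDiff

/-! ### The closed loop in decoupling coordinates -/

/-- The state `(Z, ΔΩ, e, w)`, where `Z = R₀ᵀ ΔR`, `e = Z_{k,est}^∨ - Z_k^∨` is the first estimation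
error and `w = (ΔΩ_est - ΔΩ) - G e` for `G = Ω̂₀ + L₁`. -/
abbrev CoreState := Mat3 × Vec3 × Vec3 × Vec3

/-- The matrix `Ω̂₀ + L₁ = J⁻¹ ((J Ω₀)^ - Ω̂₀ J) + M₁`. -/
def Design.innovationGain (D : Design) (p : Vec3) : Mat3 := velocityBlock D.J p + D.M₁

/-- The linearization of the closed loop at the angular velocity `p` of the reference. -/
def Design.coreLinear (D : Design) (p : Vec3) (y : CoreState) : CoreState :=
  (y.1 * hat p - hat p * y.1 + hat y.2.1 - D.ke • (y.1 + y.1ᵀ),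
   -(D.kP • skewVec y.1) - D.KD *ᵥ y.2.1
    - ((velocityBlock D.J p + D.KD) *ᵥ (y.2.2.2 + D.innovationGain p *ᵥ y.2.2.1)
      + D.kP • y.2.2.1),
   y.2.2.2,
   -(D.M₂ *ᵥ y.2.2.1) - D.M₁ *ᵥ y.2.2.2)

/-- The higher-order terms of the attitude error, rescaled by `s`. -/
def Design.attitudeRemainder (D : Design) (s : ℝ) (y : CoreState) : Mat3 :=
  y.1 * hat y.2.1
    - D.ke • (y.1 * (y.1 + y.1ᵀ) + y.1ᵀ * y.1 + s • (y.1 * (y.1ᵀ * y.1)))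

/-- The higher-order terms of the closed loop, rescaled by `s`. -/
def Design.coreRemainder (D : Design) (s : ℝ) (p : Vec3) (y : CoreState) : CoreState :=
  (D.attitudeRemainder s y,
   D.J⁻¹ *ᵥ ((D.J *ᵥ y.2.1) ⨯₃ y.2.1),
   -skewVec (D.attitudeRemainder s y),
   -(D.J⁻¹ *ᵥ ((D.J *ᵥ y.2.1) ⨯₃ y.2.1))
    + D.innovationGain p *ᵥ skewVec (D.attitudeRemainder s y))

/-- The closed loop in the coordinates `(Z, ΔΩ, e, w)`. -/
def Design.coreField (D : Design) (p : Vec3) (y : CoreState) : CoreState :=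
  D.coreLinear p y + D.coreRemainder 1 p y

theorem Design.contDiff_coreRemainder (D : Design) {n : WithTop ℕ∞} :
    ContDiff ℝ n (fun q : ℝ × Vec3 × CoreState => D.coreRemainder q.1 q.2.1 q.2.2) := by
  unfold coreRemainder attitudeRemainder innovationGain
  fun_prop

theorem Design.contDiff_coreField (D : Design) {n : WithTop ℕ∞} :
    ContDiff ℝ n (fun q : Vec3 × CoreState => D.coreField q.1 q.2) := by
  have h : ContDiff ℝ n (fun q : Vec3 × CoreState => D.coreRemainder 1 q.1 q.2) :=
    D.contDiff_coreRemainder.comp (contDiff_const.prodMk (contDiff_fst.prodMk contDiff_snd))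
  refine ContDiff.add ?_ h
  unfold coreLinear innovationGain
  fun_prop

/-- Quadratic terms scale by s² and the one cubic term by s³, so after s² is factored out the cubic
term keeps a coefficient s. What is left is polynomial in s and hence bounded on compact sets, which
yields the quadratic bound on the remainder. -/
theorem Design.coreRemainder_smul (D : Design) (s : ℝ) (p : Vec3) (y : CoreState) :
    D.coreRemainder 1 p (s • y) = s ^ 2 • D.coreRemainder s p y := by
  have h : D.attitudeRemainder 1 (s • y) = s ^ 2 • D.attitudeRemainder s y := by
    simp only [attitudeRemainder, Prod.smul_fst, Prod.smul_snd, hat_smul, Matrix.transpose_smul,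
      Matrix.smul_mul, Matrix.mul_smul, Matrix.mul_add, smul_add, smul_sub, smul_smul]
    module
  simp only [coreRemainder, h, Prod.smul_fst, Prod.smul_snd, Matrix.mulVec_smul, map_smul,
    LinearMap.smul_apply, skewVec_smul, smul_smul, Prod.smul_mk, smul_add, smul_neg, pow_two]

/-- The higher-order terms are quadratically small, uniformly in bounded `p`. -/
theorem Design.exists_coreRemainder_le (D : Design) (C : ℝ) :
    ∃ β : ℝ, 0 ≤ β ∧ ∀ p, ‖p‖ ≤ C → ∀ y : CoreState, ‖y‖ ≤ 1 →
      ‖D.coreRemainder 1 p y‖ ≤ β * ‖y‖ ^ 2 := by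
  obtain ⟨β, hβ⟩ := ((isCompact_Icc (a := (0 : ℝ)) (b := 1)).prod
    ((isCompact_closedBall (0 : Vec3) C).prod
      (isCompact_closedBall (0 : CoreState) 1))).exists_bound_of_continuousOn
    (D.contDiff_coreRemainder (n := 0)).continuous.continuousOn
  refine ⟨max β 0, le_max_right _ _, fun p hp y hy => ?_⟩
  rcases eq_or_ne y 0 with rfl | hne
  · have := D.coreRemainder_smul 0 p 0
    simp only [zero_smul, ne_eq, OfNat.ofNat_ne_zero, not_false_eq_true, zero_pow] at this
    simp [this]
  · have hn : ‖y‖ ≠ 0 := norm_ne_zero_iff.2 hne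
    have hunit : ‖‖y‖⁻¹ • y‖ = 1 := by
      rw [norm_smul, norm_inv, norm_norm, inv_mul_cancel₀ hn]
    have h := hβ (‖y‖, p, ‖y‖⁻¹ • y)
      ⟨⟨norm_nonneg _, hy⟩, by simpa using hp, by simpa using hunit.le⟩
    -- Scaling with s = ‖y‖ ≤ 1 moves the estimate to the unit vector y/‖y‖, where the compactness
    -- bound applies.
    have he : D.coreRemainder 1 p y = ‖y‖ ^ 2 • D.coreRemainder ‖y‖ p (‖y‖⁻¹ • y) := by
      rw [← D.coreRemainder_smul, smul_inv_smul₀ hn]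
    rw [he, norm_smul, norm_pow, norm_norm, mul_comm]
    exact mul_le_mul_of_nonneg_right (h.trans (le_max_left _ _)) (sq_nonneg _)

/-! ### A quadratic Lyapunov function -/

/-- A continuous positive function that is homogeneous of degree two dominates a multiple of the
squared norm. -/
theorem exists_mul_norm_sq_le {F : Type*} [NormedAddCommGroup F] [NormedSpace ℝ F]
    [FiniteDimensional ℝ F] {S : F → ℝ} (hS : Continuous S)
    (hhom : ∀ (c : ℝ) y, S (c • y) = c ^ 2 * S y) (hpos : ∀ y, y ≠ 0 → 0 < S y) :
    ∃ m : ℝ, 0 < m ∧ ∀ y, m * ‖y‖ ^ 2 ≤ S y := by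
  have h0 : S 0 = 0 := by simpa using hhom 0 0
  have hunit : ∀ y : F, y ≠ 0 → ‖y‖⁻¹ • y ∈ sphere (0 : F) 1 := fun y hy => by
    rw [mem_sphere_zero_iff_norm, norm_smul, norm_inv, norm_norm,
      inv_mul_cancel₀ (norm_ne_zero_iff.2 hy)]
  -- The sphere is empty exactly when the space is trivial; otherwise the minimum of S on it is the
  -- required constant.
  rcases (sphere (0 : F) 1).eq_empty_or_nonempty with he | hne
  · refine ⟨1, one_pos, fun y => ?_⟩
    have hy : y = 0 := by
      by_contra hy
      have := hunit y hy
      simp [he] at this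
    simp [hy, h0]
  · obtain ⟨y₀, hy₀, hmin⟩ := (isCompact_sphere (0 : F) 1).exists_isMinOn hne hS.continuousOn
    refine ⟨S y₀, hpos _ (ne_zero_of_mem_unit_sphere ⟨y₀, hy₀⟩), fun y => ?_⟩
    rcases eq_or_ne y 0 with rfl | hy
    · simp [h0]
    · have h1 : S y₀ ≤ S (‖y‖⁻¹ • y) := hmin (hunit y hy)
      have h2 : S y = ‖y‖ ^ 2 * S (‖y‖⁻¹ • y) := by
        rw [← hhom, smul_inv_smul₀ (norm_ne_zero_iff.2 hy)]
      rw [h2, mul_comm]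
      exact mul_le_mul_of_nonneg_left h1 (sq_nonneg _)

theorem exists_mul_norm_sq_le_dotProduct_mulVec {P : Mat3} (hP : P.PosDef) :
    ∃ m : ℝ, 0 < m ∧ ∀ a : Vec3, m * ‖a‖ ^ 2 ≤ a ⬝ᵥ P *ᵥ a := by
  refine exists_mul_norm_sq_le (by fun_prop) (fun c a => ?_) (fun a ha => ?_)
  · simp only [Matrix.mulVec_smul, dotProduct_smul, smul_dotProduct, smul_eq_mul]; ring
  · simpa using hP.dotProduct_mulVec_pos ha

theorem dotProduct_mulVec_comm_of_posDef {P : Mat3} (hP : P.PosDef) (a b : Vec3) :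
    a ⬝ᵥ P *ᵥ b = b ⬝ᵥ P *ᵥ a := by
  have hT : Pᵀ = P := by simpa using hP.isHermitian.eq
  rw [Matrix.dotProduct_mulVec, ← Matrix.mulVec_transpose, hT, dotProduct_comm]

/-- The factor is the dimension, because ‖·‖ is the maximum norm. -/
theorem abs_dotProduct_le (a b : Vec3) : |a ⬝ᵥ b| ≤ 3 * (‖a‖ * ‖b‖) := by
  have h : ∀ i, |a i * b i| ≤ ‖a‖ * ‖b‖ := fun i => by
    rw [abs_mul]
    exact mul_le_mul (norm_le_pi_norm a i) (norm_le_pi_norm b i) (abs_nonneg _) (norm_nonneg _)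
  rw [dotProduct, Fin.sum_univ_three]
  refine (abs_add_three _ _ _).trans ?_
  linarith [h 0, h 1, h 2]

theorem norm_sq_le_dotProduct_self (a : Vec3) : ‖a‖ ^ 2 ≤ a ⬝ᵥ a := by
  have h0 : 0 ≤ a ⬝ᵥ a := by
    rw [dotProduct, Fin.sum_univ_three]; nlinarith [sq_nonneg (a 0), sq_nonneg (a 1), sq_nonneg (a 2)]
  have h : ‖a‖ ≤ Real.sqrt (a ⬝ᵥ a) := by
    rw [pi_norm_le_iff_of_nonneg (Real.sqrt_nonneg _)]
    intro i
    refine Real.abs_le_sqrt ?_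
    rw [dotProduct, Fin.sum_univ_three]
    fin_cases i <;> simp <;> nlinarith [sq_nonneg (a 0), sq_nonneg (a 1), sq_nonneg (a 2)]
  calc ‖a‖ ^ 2 ≤ Real.sqrt (a ⬝ᵥ a) ^ 2 := by gcongr
    _ = a ⬝ᵥ a := Real.sq_sqrt h0

/-- The quadratic form `a · P a + b · b + 2 ε a · b` is a strict Lyapunov function of the second
order system `a' = r + b`, `b' = -P a - D b`, where `r` is `P`-orthogonal to `a`. -/
theorem exists_lyapunov_secondOrder {P D : Mat3} (hP : P.PosDef) (hD : D.PosDef) (C : ℝ) :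
    ∃ ε η : ℝ, 0 < ε ∧ 0 < η ∧
      (∀ a b : Vec3, η * (‖a‖ ^ 2 + ‖b‖ ^ 2) ≤ a ⬝ᵥ P *ᵥ a + b ⬝ᵥ b + ε * (a ⬝ᵥ b + b ⬝ᵥ a)) ∧
      ∀ a b r : Vec3, ‖r‖ ≤ C * ‖a‖ → a ⬝ᵥ P *ᵥ r = 0 →
        a ⬝ᵥ P *ᵥ (r + b) + b ⬝ᵥ (-(P *ᵥ a) - D *ᵥ b)
          + ε * (a ⬝ᵥ (-(P *ᵥ a) - D *ᵥ b) + b ⬝ᵥ (r + b)) ≤ -η * (‖a‖ ^ 2 + ‖b‖ ^ 2) := by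
  obtain ⟨m, hm, hmP⟩ := exists_mul_norm_sq_le_dotProduct_mulVec hP
  obtain ⟨d, hd, hdD⟩ := exists_mul_norm_sq_le_dotProduct_mulVec hD
  set c : ℝ := ‖mulVecL D‖ with hc
  have hDb : ∀ b : Vec3, ‖D *ᵥ b‖ ≤ c * ‖b‖ := (mulVecL D).le_opNorm
  set K : ℝ := 3 * (|C| + c) with hK
  have hc0 : 0 ≤ c := norm_nonneg _
  have hK0 : 0 ≤ K := by positivity
  set Q : ℝ := 3 + K ^ 2 / (2 * m) with hQ
  have hQ0 : 0 < Q := by positivity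
  -- The derivative of the cross term is at most -(m/2)‖a‖² + Q‖b‖²; with ε Q ≤ d/2 its bad part
  -- costs half of the damping. The other two bounds keep the form positive: the cross term is at
  -- most 3ε(‖a‖² + ‖b‖²) in absolute value, half of what the diagonal part provides.
  obtain ⟨ε, hε, hε1, hε2, hε3⟩ : ∃ ε : ℝ, 0 < ε ∧ ε * Q ≤ d / 2 ∧ ε ≤ m / 6 ∧ ε ≤ 1 / 6 := by
    refine ⟨min (d / 2 / Q) (min (m / 6) (1 / 6)), by positivity, ?_, ?_, ?_⟩
    · rw [← le_div_iff₀ hQ0]; exact min_le_left _ _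
    · exact (min_le_right _ _).trans (min_le_left _ _)
    · exact (min_le_right _ _).trans (min_le_right _ _)
  -- The first two bounds are what remains for positivity, the last two what remains for decay.
  obtain ⟨η, hη, hη1, hη2, hη3, hη4⟩ : ∃ η : ℝ, 0 < η ∧ η ≤ m / 2 ∧ η ≤ 1 / 2 ∧
      η ≤ ε * m / 2 ∧ η ≤ d / 2 := by
    refine ⟨min (min (m / 2) (1 / 2)) (min (ε * m / 2) (d / 2)), by positivity, ?_, ?_, ?_, ?_⟩
    · exact (min_le_left _ _).trans (min_le_left _ _)
    · exact (min_le_left _ _).trans (min_le_right _ _)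
    · exact (min_le_right _ _).trans (min_le_left _ _)
    · exact (min_le_right _ _).trans (min_le_right _ _)
  refine ⟨ε, η, hε, hη, fun a b => ?_, fun a b r hr har => ?_⟩
  · have h1 := abs_le.1 (abs_dotProduct_le a b)
    have h2 : 2 * (‖a‖ * ‖b‖) ≤ ‖a‖ ^ 2 + ‖b‖ ^ 2 := by nlinarith [sq_nonneg (‖a‖ - ‖b‖)]
    have h3 : -(3 * ε * (‖a‖ ^ 2 + ‖b‖ ^ 2)) ≤ ε * (a ⬝ᵥ b + b ⬝ᵥ a) := by
      rw [dotProduct_comm b a]; nlinarith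
    have h4 : η * ‖a‖ ^ 2 ≤ m / 2 * ‖a‖ ^ 2 := by gcongr
    have h5 : η * ‖b‖ ^ 2 ≤ 1 / 2 * ‖b‖ ^ 2 := by gcongr
    have h6 : ε * ‖a‖ ^ 2 ≤ m / 6 * ‖a‖ ^ 2 := by gcongr
    have h7 : ε * ‖b‖ ^ 2 ≤ 1 / 6 * ‖b‖ ^ 2 := by gcongr
    linarith [hmP a, norm_sq_le_dotProduct_self b]
  · have hr' : ‖r‖ ≤ |C| * ‖a‖ :=
      hr.trans (mul_le_mul_of_nonneg_right (le_abs_self C) (norm_nonneg a))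
    have e1 : b ⬝ᵥ r ≤ 3 * |C| * (‖a‖ * ‖b‖) := by
      have := (abs_le.1 (abs_dotProduct_le b r)).2
      nlinarith [mul_le_mul_of_nonneg_left hr' (norm_nonneg b)]
    have e2 : -(a ⬝ᵥ D *ᵥ b) ≤ 3 * c * (‖a‖ * ‖b‖) := by
      have := (abs_le.1 (abs_dotProduct_le a (D *ᵥ b))).1
      nlinarith [mul_le_mul_of_nonneg_left (hDb b) (norm_nonneg a)]
    have e3 : b ⬝ᵥ b ≤ 3 * ‖b‖ ^ 2 := by
      have := (abs_le.1 (abs_dotProduct_le b b)).2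
      nlinarith
    have e4 : K * (‖a‖ * ‖b‖) ≤ m / 2 * ‖a‖ ^ 2 + K ^ 2 / (2 * m) * ‖b‖ ^ 2 := by
      have h : m / 2 * ‖a‖ ^ 2 + K ^ 2 / (2 * m) * ‖b‖ ^ 2 - K * (‖a‖ * ‖b‖)
          = (m * ‖a‖ - K * ‖b‖) ^ 2 / (2 * m) := by field_simp; ring
      have h' : 0 ≤ (m * ‖a‖ - K * ‖b‖) ^ 2 / (2 * m) := by positivity
      linarith
    have e5 : a ⬝ᵥ (-(P *ᵥ a) - D *ᵥ b) + b ⬝ᵥ (r + b) ≤ -(m / 2) * ‖a‖ ^ 2 + Q * ‖b‖ ^ 2 := by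
      rw [dotProduct_sub, dotProduct_neg, dotProduct_add]
      linarith [hmP a]
    -- Without the cross term the P-contributions cancel and only the damping in b is left; the
    -- decay in a comes from `e5`, multiplied by ε.
    have e6 : a ⬝ᵥ P *ᵥ (r + b) + b ⬝ᵥ (-(P *ᵥ a) - D *ᵥ b) ≤ -d * ‖b‖ ^ 2 := by
      rw [Matrix.mulVec_add, dotProduct_add, har, dotProduct_sub, dotProduct_neg,
        dotProduct_mulVec_comm_of_posDef hP a b]
      linarith [hdD b]
    have e7 := mul_le_mul_of_nonneg_left e5 hε.le
    have e8 : ε * Q * ‖b‖ ^ 2 ≤ d / 2 * ‖b‖ ^ 2 := by gcongr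
    have e9 : η * ‖a‖ ^ 2 ≤ ε * m / 2 * ‖a‖ ^ 2 := by gcongr
    have e10 : η * ‖b‖ ^ 2 ≤ d / 2 * ‖b‖ ^ 2 := by gcongr
    linarith

/-- The quadratic Lyapunov form of the closed loop as a function of two states. -/
def Design.lyapunovFun (D : Design) (ε₁ ε₂ μ : ℝ) (y y' : CoreState) : ℝ :=
  ((symPart y.1 : Mat3)ᵀ * symPart y'.1).trace
    + (skewVec y.1 ⬝ᵥ (D.kP • (1 : Mat3)) *ᵥ skewVec y'.1 + y.2.1 ⬝ᵥ y'.2.1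
      + ε₁ * (skewVec y.1 ⬝ᵥ y'.2.1 + y.2.1 ⬝ᵥ skewVec y'.1))
    + μ * (y.2.2.1 ⬝ᵥ D.M₂ *ᵥ y'.2.2.1 + y.2.2.2 ⬝ᵥ y'.2.2.2
      + ε₂ * (y.2.2.1 ⬝ᵥ y'.2.2.2 + y.2.2.2 ⬝ᵥ y'.2.2.1))

theorem symPart_add (A B : Mat3) : symPart (A + B) = symPart A + symPart B :=
  map_add symPartL A B

theorem symPart_smul (c : ℝ) (A : Mat3) : symPart (c • A) = c • symPart A :=
  map_smul symPartL c A

/-- The quadratic Lyapunov form of the closed loop as a continuous bilinear form. -/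
def Design.lyapunovForm (D : Design) (ε₁ ε₂ μ : ℝ) : CoreState →L[ℝ] CoreState →L[ℝ] ℝ :=
  (LinearMap.mk₂ ℝ (D.lyapunovFun ε₁ ε₂ μ)
    (fun y₁ y₂ y' => by
      simp only [lyapunovFun, Prod.fst_add, Prod.snd_add, symPart_add, skewVec_add,
        Submodule.coe_add, Matrix.transpose_add, Matrix.add_mul, Matrix.trace_add, add_dotProduct]
      ring)
    (fun c y y' => by
      simp only [lyapunovFun, Prod.smul_fst, Prod.smul_snd, symPart_smul, skewVec_smul,
        Submodule.coe_smul, Matrix.transpose_smul, Matrix.smul_mul, Matrix.trace_smul,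
        smul_dotProduct, smul_eq_mul]
      ring)
    (fun y y₁ y₂ => by
      simp only [lyapunovFun, Prod.fst_add, Prod.snd_add, symPart_add, skewVec_add,
        Submodule.coe_add, Matrix.mul_add, Matrix.mulVec_add, Matrix.trace_add, dotProduct_add]
      ring)
    (fun c y y' => by
      simp only [lyapunovFun, Prod.smul_fst, Prod.smul_snd, symPart_smul, skewVec_smul,
        Submodule.coe_smul, Matrix.mul_smul, Matrix.mulVec_smul, Matrix.trace_smul,
        dotProduct_smul, smul_eq_mul]
      ring)).toContinuousBilinearMap

theorem Design.lyapunovForm_symm (D : Design) (hM₂ : D.M₂.PosDef) (ε₁ ε₂ μ : ℝ)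
    (y y' : CoreState) : D.lyapunovForm ε₁ ε₂ μ y y' = D.lyapunovForm ε₁ ε₂ μ y' y := by
  change D.lyapunovFun ε₁ ε₂ μ y y' = D.lyapunovFun ε₁ ε₂ μ y' y
  have h1 : ((symPart y.1 : Mat3)ᵀ * symPart y'.1).trace
      = ((symPart y'.1 : Mat3)ᵀ * symPart y.1).trace := by
    rw [← Matrix.trace_transpose, Matrix.transpose_mul, Matrix.transpose_transpose]
  have h2 := dotProduct_mulVec_comm_of_posDef hM₂ y.2.2.1 y'.2.2.1
  simp only [lyapunovFun, h1, h2, Matrix.smul_mulVec, Matrix.one_mulVec, dotProduct_smul]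
  rw [dotProduct_comm (skewVec y.1) (skewVec y'.1), dotProduct_comm y.2.1 y'.2.1,
    dotProduct_comm y.2.2.2 y'.2.2.2, dotProduct_comm (skewVec y.1) y'.2.1,
    dotProduct_comm y.2.1 (skewVec y'.1), dotProduct_comm y.2.2.1 y'.2.2.2,
    dotProduct_comm y.2.2.2 y'.2.2.1]
  ring

/-- The commutator of two hats is the hat of the cross product, while the commutator of a symmetric
matrix with p̂ is symmetric, as is Z + Zᵀ. The skew part thus evolves independently of the symmetric
part and of kₑ. -/
theorem skewVec_coreLinear (D : Design) (p : Vec3) (y : CoreState) :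
    skewVec (D.coreLinear p y).1 = -(hat p *ᵥ skewVec y.1) + y.2.1 := by
  obtain ⟨Z, v, e, w⟩ := y
  ext i
  fin_cases i <;>
    simp [Design.coreLinear, skewVec, skewPart, vee, hat, Matrix.mul_apply, Matrix.vecMul,
      dotProduct, Fin.sum_univ_three] <;> ring

/-- Only [S, p̂] - 2 kₑ S drives the symmetric part S, and tr(S [S, p̂]) = 0 by cyclicity of the
trace; so the rate does not depend on p. -/
theorem trace_symPart_coreLinear (D : Design) (p : Vec3) (y : CoreState) :
    ((symPart y.1 : Mat3)ᵀ * symPart (D.coreLinear p y).1).trace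
      = -2 * D.ke * ((symPart y.1 : Mat3)ᵀ * symPart y.1).trace := by
  obtain ⟨Z, v, e, w⟩ := y
  simp [Design.coreLinear, symPart, hat, Matrix.trace, Matrix.mul_apply, Matrix.vecMul, dotProduct,
    Fin.sum_univ_three]
  ring

theorem dotProduct_hat_mulVec_self (p q : Vec3) : q ⬝ᵥ hat p *ᵥ q = 0 := by
  simp [hat, Matrix.mulVec, dotProduct, Fin.sum_univ_three]; ring

theorem trace_transpose_mul_self_eq_sum (A : Mat3) :
    (Aᵀ * A).trace = ∑ i, ∑ j, A i j ^ 2 := by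
  simp [Matrix.trace, Matrix.mul_apply, Fin.sum_univ_three]; ring

/-- The sum of the squared norms of the components of a state. -/
def sqSize (y : CoreState) : ℝ :=
  ((symPart y.1 : Mat3)ᵀ * symPart y.1).trace
    + (‖skewVec y.1‖ ^ 2 + ‖y.2.1‖ ^ 2) + (‖y.2.2.1‖ ^ 2 + ‖y.2.2.2‖ ^ 2)

theorem trace_symPart_nonneg (A : Mat3) : 0 ≤ ((symPart A : Mat3)ᵀ * symPart A).trace := by
  rw [trace_transpose_mul_self_eq_sum]; positivity

/-- A matrix is determined by its symmetric and skew parts, so `sqSize` is definite. It is the gauge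
in which the block estimates add up. -/
theorem exists_mul_norm_sq_le_sqSize :
    ∃ m : ℝ, 0 < m ∧ ∀ y : CoreState, m * ‖y‖ ^ 2 ≤ sqSize y := by
  refine exists_mul_norm_sq_le ?_ (fun c y => ?_) (fun y hy => ?_)
  · have h1 : Continuous fun y : CoreState => (symPart y.1 : Mat3) :=
      continuous_subtype_val.comp (symPartL.continuous.comp continuous_fst)
    have h2 : Continuous fun y : CoreState => skewVec y.1 :=
      skewVecL.continuous.comp continuous_fst
    have h3 : Continuous fun y : CoreState => ((symPart y.1 : Mat3)ᵀ * symPart y.1).trace :=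
      (h1.matrix_transpose.matrix_mul h1).matrix_trace
    unfold sqSize
    fun_prop
  · simp only [sqSize, Prod.smul_fst, Prod.smul_snd, symPart_smul, skewVec_smul,
      Submodule.coe_smul, Matrix.transpose_smul, Matrix.smul_mul, Matrix.mul_smul,
      Matrix.trace_smul, norm_smul, smul_eq_mul, mul_pow, Real.norm_eq_abs, sq_abs]
    ring
  · have ht := trace_symPart_nonneg y.1
    by_contra hcon
    have hz : ∀ {x : ℝ}, x ^ 2 ≤ 0 → x = 0 := fun h =>
      pow_eq_zero_iff two_ne_zero |>.1 (le_antisymm h (sq_nonneg _))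
    simp only [sqSize, not_lt] at hcon
    have e1 := sq_nonneg ‖skewVec y.1‖
    have e2 := sq_nonneg ‖y.2.1‖
    have e3 := sq_nonneg ‖y.2.2.1‖
    have e4 := sq_nonneg ‖y.2.2.2‖
    have f1 : skewVec y.1 = 0 := norm_eq_zero.1 (hz (by linarith))
    have f2 : y.2.1 = 0 := norm_eq_zero.1 (hz (by linarith))
    have f3 : y.2.2.1 = 0 := norm_eq_zero.1 (hz (by linarith))
    have f4 : y.2.2.2 = 0 := norm_eq_zero.1 (hz (by linarith))
    have f5 : (symPart y.1 : Mat3) = 0 := by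
      have h : ((symPart y.1 : Mat3)ᵀ * symPart y.1).trace = 0 := by linarith
      rw [trace_transpose_mul_self_eq_sum] at h
      ext i j
      have h' := (Finset.sum_eq_zero_iff_of_nonneg
        (fun i _ => Finset.sum_nonneg fun j _ => sq_nonneg _)).1 h i (Finset.mem_univ i)
      exact pow_eq_zero_iff two_ne_zero |>.1
        ((Finset.sum_eq_zero_iff_of_nonneg (fun j _ => sq_nonneg _)).1 h' j (Finset.mem_univ j))
    have f6 : y.1 = 0 := by
      rw [← symPart_add_hat_skewVec y.1, f5, f1]
      exact (zero_add _).trans (map_zero hatL)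
    exact hy (Prod.ext f6 (Prod.ext f2 (Prod.ext f3 f4)))

/-- The angular velocity feedback is perturbed by this function of the estimation error. -/
def Design.forcing (D : Design) (p e w : Vec3) : Vec3 :=
  (velocityBlock D.J p + D.KD) *ᵥ (w + D.innovationGain p *ᵥ e) + D.kP • e

/-- The forcing of the angular velocity error by the estimation error. -/
theorem Design.exists_forcing_le (D : Design) (C : ℝ) :
    ∃ K : ℝ, ∀ p, ‖p‖ ≤ C → ∀ e w : Vec3,
      ‖D.forcing p e w‖ ≤ K * (‖e‖ + ‖w‖) := by
  have hc1 : ContDiff ℝ 0 fun p => mulVecL (velocityBlock D.J p + D.KD) :=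
    mulVecL.contDiff.comp (by fun_prop)
  have hc2 : ContDiff ℝ 0 fun p => mulVecL (D.innovationGain p) :=
    mulVecL.contDiff.comp (by unfold innovationGain; fun_prop)
  obtain ⟨K₁, hK₁⟩ := (isCompact_closedBall (0 : Vec3) C).exists_bound_of_continuousOn
    hc1.continuous.continuousOn
  obtain ⟨K₂, hK₂⟩ := (isCompact_closedBall (0 : Vec3) C).exists_bound_of_continuousOn
    hc2.continuous.continuousOn
  refine ⟨|K₁| * (1 + |K₂|) + |D.kP|, fun p hp e w => ?_⟩
  have hp' : p ∈ closedBall (0 : Vec3) C := by simpa using hp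
  have h1 : ∀ x, ‖(velocityBlock D.J p + D.KD) *ᵥ x‖ ≤ |K₁| * ‖x‖ := fun x =>
    ((mulVecL (velocityBlock D.J p + D.KD)).le_opNorm x).trans
      (mul_le_mul_of_nonneg_right ((hK₁ p hp').trans (le_abs_self _)) (norm_nonneg _))
  have h2 : ∀ x, ‖D.innovationGain p *ᵥ x‖ ≤ |K₂| * ‖x‖ := fun x =>
    ((mulVecL (D.innovationGain p)).le_opNorm x).trans
      (mul_le_mul_of_nonneg_right ((hK₂ p hp').trans (le_abs_self _)) (norm_nonneg _))
  have hA : 0 ≤ |K₁| := abs_nonneg _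
  have hB : 0 ≤ |K₂| := abs_nonneg _
  have he := norm_nonneg e
  have hw := norm_nonneg w
  calc _ ≤ |K₁| * ‖w + D.innovationGain p *ᵥ e‖ + |D.kP| * ‖e‖ := by
        refine (norm_add_le _ _).trans (add_le_add (h1 _) ?_)
        rw [norm_smul, Real.norm_eq_abs]
    _ ≤ |K₁| * (‖w‖ + |K₂| * ‖e‖) + |D.kP| * ‖e‖ := by
        gcongr
        exact (norm_add_le _ _).trans (add_le_add le_rfl (h2 e))
    _ ≤ (|K₁| * (1 + |K₂|) + |D.kP|) * (‖e‖ + ‖w‖) := by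
        have t1 := mul_nonneg hA he
        have t2 := mul_nonneg (mul_nonneg hA hB) hw
        have t3 := mul_nonneg (abs_nonneg D.kP) hw
        nlinarith

/-- The derivative of the Lyapunov form along the linearization. -/
theorem Design.lyapunovFun_coreLinear (D : Design) (ε₁ ε₂ μ : ℝ) (p : Vec3) (Z : Mat3)
    (v e w : Vec3) :
    D.lyapunovFun ε₁ ε₂ μ (Z, v, e, w) (D.coreLinear p (Z, v, e, w))
      = -2 * D.ke * ((symPart Z : Mat3)ᵀ * symPart Z).trace
        + (skewVec Z ⬝ᵥ (D.kP • (1 : Mat3)) *ᵥ (-(hat p *ᵥ skewVec Z) + v)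
          + v ⬝ᵥ (-((D.kP • (1 : Mat3)) *ᵥ skewVec Z) - D.KD *ᵥ v)
          + ε₁ * (skewVec Z ⬝ᵥ (-((D.kP • (1 : Mat3)) *ᵥ skewVec Z) - D.KD *ᵥ v)
            + v ⬝ᵥ (-(hat p *ᵥ skewVec Z) + v)))
        + (-(v ⬝ᵥ D.forcing p e w) - ε₁ * (skewVec Z ⬝ᵥ D.forcing p e w))
        + μ * (e ⬝ᵥ D.M₂ *ᵥ (0 + w) + w ⬝ᵥ (-(D.M₂ *ᵥ e) - D.M₁ *ᵥ w)
          + ε₂ * (e ⬝ᵥ (-(D.M₂ *ᵥ e) - D.M₁ *ᵥ w) + w ⬝ᵥ (0 + w))) := by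
  have hs := trace_symPart_coreLinear D p (Z, v, e, w)
  have hk := skewVec_coreLinear D p (Z, v, e, w)
  have hv : (D.coreLinear p (Z, v, e, w)).2.1
      = -((D.kP • (1 : Mat3)) *ᵥ skewVec Z) - D.KD *ᵥ v - D.forcing p e w := by
    simp only [coreLinear, Matrix.smul_mulVec, Matrix.one_mulVec, forcing]
  have he : (D.coreLinear p (Z, v, e, w)).2.2.1 = w := rfl
  have hw : (D.coreLinear p (Z, v, e, w)).2.2.2 = -(D.M₂ *ᵥ e) - D.M₁ *ᵥ w := rfl
  dsimp only at hs hk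
  simp only [lyapunovFun, hs, hk, hv, he, hw, zero_add, dotProduct_sub _ _ (D.forcing p e w)]
  ring

/-- Young's inequality for the coupling of the tracking error to the estimation error. -/
theorem coupling_le {q v e w f : Vec3} {K ε η L : ℝ} (hε : 0 < ε) (hη : 0 < η)
    (hL : L = 3 * K * (1 + ε)) (hf : ‖f‖ ≤ K * (‖e‖ + ‖w‖)) :
    -(v ⬝ᵥ f) - ε * (q ⬝ᵥ f)
      ≤ η / 2 * (‖q‖ ^ 2 + ‖v‖ ^ 2) + 2 * L ^ 2 / η * (‖e‖ ^ 2 + ‖w‖ ^ 2) := by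
  have g1 := (abs_le.1 (abs_dotProduct_le v f)).1
  have g2 := (abs_le.1 (abs_dotProduct_le q f)).1
  have n1 := norm_nonneg q
  have n2 := norm_nonneg v
  have n3 := norm_nonneg e
  have n4 := norm_nonneg w
  have i1 : -(v ⬝ᵥ f) - ε * (q ⬝ᵥ f) ≤ 3 * (‖v‖ + ε * ‖q‖) * ‖f‖ := by
    have := mul_le_mul_of_nonneg_left g2 hε.le
    linarith
  have i2 : 3 * (‖v‖ + ε * ‖q‖) * ‖f‖ ≤ 3 * ((1 + ε) * (‖q‖ + ‖v‖)) * (K * (‖e‖ + ‖w‖)) := by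
    gcongr
    nlinarith
  -- Young's inequality by completing the square; the weight η/4 leaves, after the factor 2 from
  -- squaring sums, half of the tracking decay η.
  have i3 : L * (‖q‖ + ‖v‖) * (‖e‖ + ‖w‖)
      ≤ η / 4 * (‖q‖ + ‖v‖) ^ 2 + L ^ 2 / η * (‖e‖ + ‖w‖) ^ 2 := by
    have h : η / 4 * (‖q‖ + ‖v‖) ^ 2 + L ^ 2 / η * (‖e‖ + ‖w‖) ^ 2
        - L * (‖q‖ + ‖v‖) * (‖e‖ + ‖w‖)
        = (η * (‖q‖ + ‖v‖) / 2 - L * (‖e‖ + ‖w‖)) ^ 2 / η := by field_simp; ring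
    have h' : 0 ≤ (η * (‖q‖ + ‖v‖) / 2 - L * (‖e‖ + ‖w‖)) ^ 2 / η := by positivity
    linarith
  have i4 : η / 4 * (‖q‖ + ‖v‖) ^ 2 ≤ η / 4 * (2 * (‖q‖ ^ 2 + ‖v‖ ^ 2)) := by
    gcongr; exact add_sq_le
  have i5 : L ^ 2 / η * (‖e‖ + ‖w‖) ^ 2 ≤ L ^ 2 / η * (2 * (‖e‖ ^ 2 + ‖w‖ ^ 2)) := by
    gcongr; exact add_sq_le
  have i6 : 3 * ((1 + ε) * (‖q‖ + ‖v‖)) * (K * (‖e‖ + ‖w‖))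
      = L * (‖q‖ + ‖v‖) * (‖e‖ + ‖w‖) := by rw [hL]; ring
  have i7 : L ^ 2 / η * (2 * (‖e‖ ^ 2 + ‖w‖ ^ 2))
      = 2 * L ^ 2 / η * (‖e‖ ^ 2 + ‖w‖ ^ 2) := by ring
  linarith

/-- The linearization has a strict quadratic Lyapunov function, uniformly in bounded `p`. -/
theorem Design.exists_lyapunovForm (D : Design) (hke : 0 < D.ke) (hkP : 0 < D.kP)
    (hKD : D.KD.PosDef) (hM₁ : D.M₁.PosDef) (hM₂ : D.M₂.PosDef) (C : ℝ) :
    ∃ ε₁ ε₂ μ m α : ℝ, 0 < m ∧ 0 < α ∧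
      (∀ y, m * ‖y‖ ^ 2 ≤ D.lyapunovFun ε₁ ε₂ μ y y) ∧
      ∀ p, ‖p‖ ≤ C → ∀ y, D.lyapunovFun ε₁ ε₂ μ y (D.coreLinear p y) ≤ -α * ‖y‖ ^ 2 := by
  have hkP1 : (D.kP • (1 : Mat3)).PosDef := Matrix.PosDef.one.smul hkP
  obtain ⟨ε₁, η₁, hε₁, hη₁, hlow₁, hdec₁⟩ :=
    exists_lyapunov_secondOrder hkP1 hKD (‖mulVecL.comp hatL‖ * C)
  -- The estimator oscillator has no rotation term, so r = 0 and the constant C may be 0.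
  obtain ⟨ε₂, η₂, hε₂, hη₂, hlow₂, hdec₂⟩ := exists_lyapunov_secondOrder hM₂ hM₁ 0
  obtain ⟨K, hforce⟩ := D.exists_forcing_le C
  obtain ⟨m, hm, hsize⟩ := exists_mul_norm_sq_le_sqSize
  obtain ⟨L, hL⟩ : ∃ L, L = 3 * K * (1 + ε₁) := ⟨_, rfl⟩
  -- The weight μ makes the estimator decay pay for the forcing cost 2L²/η₁ and leaves a surplus of
  -- 1.
  obtain ⟨μ, hμ0, hμη⟩ : ∃ μ : ℝ, 0 < μ ∧ μ * η₂ = 2 * L ^ 2 / η₁ + 1 :=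
    ⟨(2 * L ^ 2 / η₁ + 1) / η₂, by positivity, div_mul_cancel₀ _ hη₂.ne'⟩
  obtain ⟨b, hb, hb1, hb2, hb3⟩ : ∃ b : ℝ, 0 < b ∧ b ≤ 1 ∧ b ≤ η₁ ∧ b ≤ μ * η₂ :=
    ⟨min 1 (min η₁ (μ * η₂)), by positivity, min_le_left _ _,
      (min_le_right _ _).trans (min_le_left _ _), (min_le_right _ _).trans (min_le_right _ _)⟩
  -- The three bounds are the net decay rates of the estimator, tracking and symmetric blocks.
  obtain ⟨a, ha, ha1, ha2, ha3⟩ : ∃ a : ℝ, 0 < a ∧ a ≤ 1 ∧ a ≤ η₁ / 2 ∧ a ≤ 2 * D.ke :=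
    ⟨min 1 (min (η₁ / 2) (2 * D.ke)), by positivity, min_le_left _ _,
      (min_le_right _ _).trans (min_le_left _ _), (min_le_right _ _).trans (min_le_right _ _)⟩
  refine ⟨ε₁, ε₂, μ, b * m, a * m, mul_pos hb hm, mul_pos ha hm, fun ⟨Z, v, e, w⟩ => ?_,
    fun p hp ⟨Z, v, e, w⟩ => ?_⟩
  · have h1 := hlow₁ (skewVec Z) v
    have h2 := mul_le_mul_of_nonneg_left (hlow₂ e w) hμ0.le
    have h3 := trace_symPart_nonneg Z
    have h4 := mul_le_mul_of_nonneg_left (hsize (Z, v, e, w)) hb.le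
    have h5 := mul_le_mul_of_nonneg_right hb1 h3
    have h6 := mul_le_mul_of_nonneg_right hb2
      (add_nonneg (sq_nonneg ‖skewVec Z‖) (sq_nonneg ‖v‖))
    have h7 := mul_le_mul_of_nonneg_right hb3 (add_nonneg (sq_nonneg ‖e‖) (sq_nonneg ‖w‖))
    simp only [sqSize] at h4
    simp only [lyapunovFun]
    linarith
  · have hrn : ‖-(hat p *ᵥ skewVec Z)‖ ≤ ‖mulVecL.comp hatL‖ * C * ‖skewVec Z‖ := by
      rw [norm_neg]
      refine ((mulVecL.comp hatL).le_opNorm₂ p (skewVec Z)).trans ?_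
      gcongr
    have hro : skewVec Z ⬝ᵥ (D.kP • (1 : Mat3)) *ᵥ (-(hat p *ᵥ skewVec Z)) = 0 := by
      simp only [Matrix.smul_mulVec, Matrix.one_mulVec, dotProduct_smul, dotProduct_neg,
        dotProduct_hat_mulVec_self, neg_zero, smul_zero]
    have d1 := hdec₁ (skewVec Z) v (-(hat p *ᵥ skewVec Z)) hrn hro
    have d2 := mul_le_mul_of_nonneg_left (hdec₂ e w 0 (by simp) (by simp)) hμ0.le
    have hcross := coupling_le (q := skewVec Z) (v := v) hε₁ hη₁ hL (hforce p hp e w)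
    have h4 := mul_le_mul_of_nonneg_left (hsize (Z, v, e, w)) ha.le
    simp only [sqSize] at h4
    have h5 := mul_le_mul_of_nonneg_right ha3 (trace_symPart_nonneg Z)
    have h6 := mul_le_mul_of_nonneg_right ha2
      (add_nonneg (sq_nonneg ‖skewVec Z‖) (sq_nonneg ‖v‖))
    have h7 := mul_le_mul_of_nonneg_right ha1 (add_nonneg (sq_nonneg ‖e‖) (sq_nonneg ‖w‖))
    have h8 : μ * (-η₂ * (‖e‖ ^ 2 + ‖w‖ ^ 2))
        = -(2 * L ^ 2 / η₁ + 1) * (‖e‖ ^ 2 + ‖w‖ ^ 2) := by rw [← hμη]; ring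
    rw [h8] at d2
    rw [lyapunovFun_coreLinear]
    linarith

/-- The closed loop in the coordinates `(Z, ΔΩ, e, w)` is exponentially stable along every bounded
continuous angular velocity of the reference. -/
theorem Design.isExpStable_coreField (D : Design) (hke : 0 < D.ke) (hkP : 0 < D.kP)
    (hKD : D.KD.PosDef) (hM₁ : D.M₁.PosDef) (hM₂ : D.M₂.PosDef) {Ω : ℝ → Vec3}
    (hΩ : ContinuousOn Ω (Ici 0)) (hbdd : ∃ C : ℝ, ∀ t, 0 ≤ t → ‖Ω t‖ ≤ C) :
    IsExpStable fun t y => D.coreField (Ω t) y := by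
  obtain ⟨C, hC⟩ := hbdd
  obtain ⟨ε₁, ε₂, μ, m, α, hm, hα, hlow, hdec⟩ := D.exists_lyapunovForm hke hkP hKD hM₁ hM₂ C
  obtain ⟨β, hβ, hrem⟩ := D.exists_coreRemainder_le C
  refine isExpStable_of_linearization (A := fun t y => D.coreLinear (Ω t) y)
    (N := fun t y => D.coreRemainder 1 (Ω t) y) (fun t _ y => rfl) (fun t ht => ?_)
    (fun y => ?_) (fun M => ?_) (D.lyapunovForm_symm hM₂ ε₁ ε₂ μ) hm hα hβ hlow
    (fun t ht y => hdec _ (hC t ht) y) (fun t ht y hy => hrem _ (hC t ht) y hy)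
  · have h1 : D.coreRemainder 1 (Ω t) 0 = 0 := by
      have := hrem (Ω t) (hC t ht) 0 (by simp)
      simpa using this
    have h2 : hat 0 = 0 := map_zero hatL
    have h3 : skewVec 0 = 0 := map_zero skewVecL
    simp [coreField, h1, coreLinear, h2, h3]
  · exact continuousOn_parametrized_field (D.contDiff_coreField (n := 1)) hΩ y
  · obtain ⟨K, hK⟩ := exists_lipschitzOnWith_closedBall (D.contDiff_coreField (n := 1)) C M
    exact ⟨K, fun t ht => hK _ (hC t ht)⟩

/-! ### Change of coordinates -/

/-- A continuous family of homogeneous maps is uniformly bounded for bounded parameters. -/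
theorem exists_norm_le_of_homogeneous {P E F : Type*} [NormedAddCommGroup P] [NormedSpace ℝ P]
    [FiniteDimensional ℝ P] [NormedAddCommGroup E] [NormedSpace ℝ E] [FiniteDimensional ℝ E]
    [NormedAddCommGroup F] [NormedSpace ℝ F] {H : P → E → F}
    (hH : ContDiff ℝ 1 fun q : P × E => H q.1 q.2)
    (hhom : ∀ p (c : ℝ) y, H p (c • y) = c • H p y) (C : ℝ) :
    ∃ K : ℝ, ∀ p, ‖p‖ ≤ C → ∀ y, ‖H p y‖ ≤ K * ‖y‖ := by
  have := FiniteDimensional.proper ℝ P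
  have := FiniteDimensional.proper ℝ E
  obtain ⟨K, hK⟩ := ((isCompact_closedBall (0 : P) C).prod
    (isCompact_closedBall (0 : E) 1)).exists_bound_of_continuousOn hH.continuous.continuousOn
  refine ⟨K, fun p hp y => ?_⟩
  rcases eq_or_ne y 0 with rfl | hy
  · have h0 : H p 0 = 0 := by simpa using hhom p 0 0
    simp [h0]
  · have hn : ‖y‖ ≠ 0 := norm_ne_zero_iff.2 hy
    have hunit : ‖‖y‖⁻¹ • y‖ = 1 := by
      rw [norm_smul, norm_inv, norm_norm, inv_mul_cancel₀ hn]
    have h := hK (p, ‖y‖⁻¹ • y) ⟨by simpa using hp, by simpa using hunit.le⟩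
    have he : H p y = ‖y‖ • H p (‖y‖⁻¹ • y) := by rw [← hhom, smul_inv_smul₀ hn]
    rw [he, norm_smul, norm_norm, mul_comm]
    exact mul_le_mul_of_nonneg_right h (norm_nonneg _)

section Derivatives

variable {s : Set ℝ} {t : ℝ}

theorem hasDerivWithinAt_fst {E F : Type*} [NormedAddCommGroup E] [NormedSpace ℝ E]
    [NormedAddCommGroup F] [NormedSpace ℝ F] {f : ℝ → E × F} {f' : E × F}
    (hf : HasDerivWithinAt f f' s t) : HasDerivWithinAt (fun τ => (f τ).1) f'.1 s t :=
  (ContinuousLinearMap.fst ℝ E F).hasFDerivAt.comp_hasDerivWithinAt t hf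

theorem hasDerivWithinAt_snd {E F : Type*} [NormedAddCommGroup E] [NormedSpace ℝ E]
    [NormedAddCommGroup F] [NormedSpace ℝ F] {f : ℝ → E × F} {f' : E × F}
    (hf : HasDerivWithinAt f f' s t) : HasDerivWithinAt (fun τ => (f τ).2) f'.2 s t :=
  (ContinuousLinearMap.snd ℝ E F).hasFDerivAt.comp_hasDerivWithinAt t hf

theorem hasDerivWithinAt_matrix_mul {f g : ℝ → Mat3} {f' g' : Mat3}
    (hf : HasDerivWithinAt f f' s t) (hg : HasDerivWithinAt g g' s t) :
    HasDerivWithinAt (fun τ => f τ * g τ) (f t * g' + f' * g t) s t :=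
  mulL.hasDerivWithinAt_of_bilinear hf hg

theorem hasDerivWithinAt_matrix_mulVec {f : ℝ → Mat3} {g : ℝ → Vec3} {f' : Mat3} {g' : Vec3}
    (hf : HasDerivWithinAt f f' s t) (hg : HasDerivWithinAt g g' s t) :
    HasDerivWithinAt (fun τ => f τ *ᵥ g τ) (f t *ᵥ g' + f' *ᵥ g t) s t :=
  mulVecL.hasDerivWithinAt_of_bilinear hf hg

theorem hasDerivWithinAt_matrix_transpose {f : ℝ → Mat3} {f' : Mat3}
    (hf : HasDerivWithinAt f f' s t) : HasDerivWithinAt (fun τ => (f τ)ᵀ) f'ᵀ s t :=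
  transposeL.hasFDerivAt.comp_hasDerivWithinAt t hf

theorem hasDerivWithinAt_hat {f : ℝ → Vec3} {f' : Vec3}
    (hf : HasDerivWithinAt f f' s t) : HasDerivWithinAt (fun τ => hat (f τ)) (hat f') s t :=
  hatL.hasFDerivAt.comp_hasDerivWithinAt t hf

theorem hasDerivWithinAt_skewVec {f : ℝ → Mat3} {f' : Mat3}
    (hf : HasDerivWithinAt f f' s t) : HasDerivWithinAt (fun τ => skewVec (f τ)) (skewVec f') s t :=
  skewVecL.hasFDerivAt.comp_hasDerivWithinAt t hf

theorem hasDerivWithinAt_symPart {f : ℝ → Mat3} {f' : Mat3}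
    (hf : HasDerivWithinAt f f' s t) : HasDerivWithinAt (fun τ => symPart (f τ)) (symPart f') s t :=
  symPartL.hasFDerivAt.comp_hasDerivWithinAt t hf

theorem hasDerivWithinAt_symMat3_coe {f : ℝ → SymMat3} {f' : SymMat3}
    (hf : HasDerivWithinAt f f' s t) :
    HasDerivWithinAt (fun τ => (f τ : Mat3)) (f' : Mat3) s t :=
  SymMat3.subtypeL.hasFDerivAt.comp_hasDerivWithinAt t hf

theorem velocityBlock_add (J : Mat3) (v w : Vec3) :
    velocityBlock J (v + w) = velocityBlock J v + velocityBlock J w := by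
  simp only [velocityBlock, Matrix.mulVec_add, hat_add, add_mul, ← mul_add]
  congr 1; abel

theorem velocityBlock_smul (J : Mat3) (c : ℝ) (v : Vec3) :
    velocityBlock J (c • v) = c • velocityBlock J v := by
  simp only [velocityBlock, Matrix.mulVec_smul, hat_smul, smul_mul_assoc, ← smul_sub,
    mul_smul_comm]

/-- The map `w ↦ velocityBlock J w` as a continuous linear map. -/
def velocityBlockL (J : Mat3) : Vec3 →L[ℝ] Mat3 :=
  LinearMap.toContinuousLinearMap
    { toFun := velocityBlock J
      map_add' := velocityBlock_add J
      map_smul' := velocityBlock_smul J }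

theorem hasDerivWithinAt_velocityBlock (J : Mat3) {f : ℝ → Vec3} {f' : Vec3}
    (hf : HasDerivWithinAt f f' s t) :
    HasDerivWithinAt (fun τ => velocityBlock J (f τ)) (velocityBlock J f') s t :=
  (velocityBlockL J).hasFDerivAt.comp_hasDerivWithinAt t hf

end Derivatives

theorem transpose_hat (w : Vec3) : (hat w)ᵀ = -hat w := by
  ext i j; fin_cases i <;> fin_cases j <;> simp [hat]

theorem symPart_coe_add_hat (S : SymMat3) (q : Vec3) : symPart ((S : Mat3) + hat q) = S := by
  have hS : (S : Mat3)ᵀ = S := S.2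
  apply Subtype.ext
  simp only [symPart, Matrix.transpose_add, hS, transpose_hat]
  module

theorem skewVec_coe_add_hat (S : SymMat3) (q : Vec3) : skewVec ((S : Mat3) + hat q) = q := by
  have hS : (S : Mat3)ᵀ = S := S.2
  have h : skewPart ((S : Mat3) + hat q) = hat q := by
    simp only [skewPart, Matrix.transpose_add, hS, transpose_hat]
    module
  rw [skewVec, h, vee_hat]

theorem norm_le_three_of_transpose_mul_self {R : Mat3} (hR : Rᵀ * R = 1) : ‖R‖ ≤ 3 := by
  have h : ∑ i, ∑ j, ‖R i j‖ ^ (2 : ℝ) = 3 := by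
    have h := trace_transpose_mul_self_eq_sum R
    rw [hR] at h
    simp only [Real.norm_eq_abs, Real.rpow_two, sq_abs, ← h]
    simp
  rw [Matrix.frobenius_norm_def, h]
  calc (3 : ℝ) ^ (1 / 2 : ℝ) ≤ (3 : ℝ) ^ (1 : ℝ) :=
        Real.rpow_le_rpow_of_exponent_le (by norm_num) (by norm_num)
    _ = 3 := Real.rpow_one 3

/-- The coordinates `(Z, ΔΩ, e, w)` of the state `(ΔR, ΔΩ, z)`, at the reference `(R, p)`. -/
def Design.toCore (D : Design) (R : Mat3) (p : Vec3) (x : Mat3 × Vec3 × (Vec3 × Vec3)) :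
    CoreState :=
  (Rᵀ * x.1, x.2.1, x.2.2.1 - skewVec (Rᵀ * x.1),
   x.2.2.2 - x.2.1 - D.innovationGain p *ᵥ (x.2.2.1 - skewVec (Rᵀ * x.1)))

/-- The state `(ΔR, ΔΩ, z)` with coordinates `(Z, ΔΩ, e, w)`, at the reference `(R, p)`. -/
def Design.ofCore (D : Design) (R : Mat3) (p : Vec3) (y : CoreState) :
    Mat3 × Vec3 × (Vec3 × Vec3) :=
  (R * y.1, y.2.1, y.2.2.1 + skewVec y.1,
   y.2.2.2 + y.2.1 + D.innovationGain p *ᵥ y.2.2.1)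

theorem Design.ofCore_toCore (D : Design) {R : Mat3} (hR : R * Rᵀ = 1) (p : Vec3)
    (x : Mat3 × Vec3 × (Vec3 × Vec3)) : D.ofCore R p (D.toCore R p x) = x := by
  obtain ⟨X, v, z₁, z₂⟩ := x
  have h : ∀ g : Vec3, z₂ - v - g + v + g = z₂ := fun g => by abel
  simp only [ofCore, toCore, ← mul_assoc, hR, one_mul, sub_add_cancel, h]

theorem Design.toCore_ofCore (D : Design) {R : Mat3} (hR : Rᵀ * R = 1) (p : Vec3)
    (y : CoreState) : D.toCore R p (D.ofCore R p y) = y := by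
  obtain ⟨Z, v, e, w⟩ := y
  have h : ∀ g : Vec3, w + v + g - v - g = w := fun g => by abel
  simp only [ofCore, toCore, ← mul_assoc, hR, one_mul, add_sub_cancel_right, h]

theorem Design.exists_norm_toCore_le (D : Design) (C : ℝ) :
    ∃ K : ℝ, ∀ R p, ‖R‖ ≤ 3 → ‖p‖ ≤ C → ∀ x, ‖D.toCore R p x‖ ≤ K * ‖x‖ := by
  obtain ⟨K, hK⟩ := exists_norm_le_of_homogeneous
    (H := fun (q : Mat3 × Vec3) x => D.toCore q.1 q.2 x)
    (by unfold toCore innovationGain; fun_prop)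
    (fun q c x => by
      simp only [toCore, Prod.smul_fst, Prod.smul_snd, mul_smul_comm, skewVec_smul, ← smul_sub,
        Matrix.mulVec_smul, Prod.smul_mk]) (max 3 C)
  exact ⟨K, fun R p hR hp => hK (R, p) (max_le_max hR hp)⟩

theorem Design.exists_norm_ofCore_le (D : Design) (C : ℝ) :
    ∃ K : ℝ, ∀ R p, ‖R‖ ≤ 3 → ‖p‖ ≤ C → ∀ y, ‖D.ofCore R p y‖ ≤ K * ‖y‖ := by
  obtain ⟨K, hK⟩ := exists_norm_le_of_homogeneous
    (H := fun (q : Mat3 × Vec3) y => D.ofCore q.1 q.2 y)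
    (by unfold ofCore innovationGain; fun_prop)
    (fun q c x => by
      simp only [ofCore, Prod.smul_fst, Prod.smul_snd, mul_smul_comm, skewVec_smul, ← smul_add,
        Matrix.mulVec_smul, Prod.smul_mk]) (max 3 C)
  exact ⟨K, fun R p hR hp => hK (R, p) (max_le_max hR hp)⟩

/-! ### The error dynamics in the new coordinates -/

theorem velocityBlock_mulVec (J : Mat3) (p v : Vec3) :
    velocityBlock J p *ᵥ v = J⁻¹ *ᵥ ((J *ᵥ v) ⨯₃ p + (J *ᵥ p) ⨯₃ v) := by
  rw [velocityBlock, ← Matrix.mulVec_mulVec, Matrix.sub_mulVec, ← Matrix.mulVec_mulVec,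
    hat_mulVec, hat_mulVec, ← cross_anticomm p (J *ᵥ v)]
  congr 1; abel

/-- The attitude error dynamics in the variable `Z = Rᵀ ΔR`. -/
theorem Design.attitude_coreField (D : Design) {R : Mat3} (hR : Rᵀ * R = 1) (hR' : R * Rᵀ = 1)
    (p : Vec3) (x : Mat3 × Vec3 × (Vec3 × Vec3)) :
    (D.coreField p (D.toCore R p x)).1
      = Rᵀ * (attitudeField D.ke (R + x.1) (p + x.2.1) - attitudeField D.ke R p)
        + (R * hat p)ᵀ * x.1 := by
  obtain ⟨X, v, z⟩ := x
  obtain ⟨Z, rfl⟩ : ∃ Z, X = R * Z := ⟨Rᵀ * X, by rw [← mul_assoc, hR', one_mul]⟩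
  have hRZ : Rᵀ * (R * Z) = Z := by rw [← mul_assoc, hR, one_mul]
  have h1 : (R + R * Z)ᵀ * (R + R * Z) = (1 + Zᵀ) * (1 + Z) := by
    -- By orthogonality R drops out of Rᵀ R, so the dynamics of Z involve the reference only through
    -- p.
    have e : R + R * Z = R * (1 + Z) := by rw [mul_add, mul_one]
    rw [e, Matrix.transpose_mul, mul_assoc, ← mul_assoc Rᵀ R, hR, one_mul, Matrix.transpose_add,
      Matrix.transpose_one]
  have h2 : Rᵀ * (R + R * Z) = 1 + Z := by rw [mul_add, hR, hRZ]
  have h3 : (R * hat p)ᵀ * (R * Z) = -(hat p * Z) := by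
    rw [Matrix.transpose_mul, mul_assoc, hRZ, transpose_hat, neg_mul]
  simp only [attitudeField, h1, hR, h3, sub_self, mul_zero, smul_zero, sub_zero, mul_sub,
    mul_smul_comm, ← mul_assoc Rᵀ, h2, one_mul, hat_add]
  simp only [coreField, coreLinear, coreRemainder, attitudeRemainder, toCore, hRZ, Prod.fst_add,
    one_smul]
  simp only [mul_add, add_mul, mul_one, one_mul, smul_add, smul_sub]
  abel

/-- The two cross products in u reproduce the linearized gyroscopic term at the estimated velocity
with the opposite sign, leaving a proportional-derivative law. -/
theorem Design.inv_mulVec_control (D : Design) (hJ : D.J⁻¹ * D.J = 1) (t : ℝ) (z : Vec3 × Vec3) :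
    D.J⁻¹ *ᵥ (D.control t z - D.u₀ t)
      = -(velocityBlock D.J (D.Ω₀ t) *ᵥ z.2) - (D.kP • z.1 + D.KD *ᵥ z.2) := by
  have h : D.control t z - D.u₀ t
      = -((D.J *ᵥ z.2) ⨯₃ D.Ω₀ t + (D.J *ᵥ D.Ω₀ t) ⨯₃ z.2)
        - D.J *ᵥ (D.kP • z.1 + D.KD *ᵥ z.2) := by
    simp only [control]; abel
  rw [h, Matrix.mulVec_sub, Matrix.mulVec_neg, ← velocityBlock_mulVec, Matrix.mulVec_mulVec, hJ,
    Matrix.one_mulVec]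

/-- The Euler term is quadratic in the velocity, so its expansion at p ends with the exact remainder
J⁻¹(Jv × v). -/
theorem eulerField_sub (J : Mat3) (p v u u' : Vec3) :
    eulerField J (p + v) u - eulerField J p u'
      = velocityBlock J p *ᵥ v + J⁻¹ *ᵥ ((J *ᵥ v) ⨯₃ v) + J⁻¹ *ᵥ (u - u') := by
  rw [velocityBlock_mulVec]
  simp only [eulerField, Matrix.mulVec_add, Matrix.mulVec_sub, map_add, LinearMap.add_apply]
  abel

/-- The gyroscopic term at v and its compensation at the estimate combine to -V(ΔΩ_est - v), and
ΔΩ_est - v = w + G e: only estimation errors remain next to the feedback. -/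
theorem Design.velocity_coreField (D : Design) (hJ : D.J⁻¹ * D.J = 1) (t : ℝ)
    (x : Mat3 × Vec3 × (Vec3 × Vec3)) :
    (D.coreField (D.Ω₀ t) (D.toCore (D.R₀ t) (D.Ω₀ t) x)).2.1 = (D.errorField t x).2.1 := by
  have h : (D.errorField t x).2.1
      = eulerField D.J (D.Ω₀ t + x.2.1) (D.control t x.2.2)
        - eulerField D.J (D.Ω₀ t) (D.u₀ t) := rfl
  rw [h, eulerField_sub, D.inv_mulVec_control hJ]
  obtain ⟨X, v, z₁, z₂⟩ := x
  simp only [coreField, coreLinear, coreRemainder, toCore, Prod.snd_add, Prod.fst_add,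
    sub_add_cancel, Matrix.add_mulVec, Matrix.mulVec_sub, smul_sub]
  abel

/-- Subtracting the dynamics of q from those of its estimate gives e' = (ΔΩ_est - v) - (Ω̂₀ + L₁) e
up to the attitude remainder, and this is w by the definition of w. -/
theorem Design.observer_coreField_fst (D : Design) (t : ℝ) (x : Mat3 × Vec3 × (Vec3 × Vec3)) :
    (D.coreField (D.Ω₀ t) (D.toCore (D.R₀ t) (D.Ω₀ t) x)).2.2.1
      = (D.errorField t x).2.2.1
        - skewVec (D.coreField (D.Ω₀ t) (D.toCore (D.R₀ t) (D.Ω₀ t) x)).1 := by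
  have h : (D.errorField t x).2.2.1
      = -(hat (D.Ω₀ t) *ᵥ x.2.2.1) + x.2.2.2
        - gain₁ D.J D.M₁ D.Ω₀ t *ᵥ (x.2.2.1 - skewVec ((D.R₀ t)ᵀ * x.1)) := rfl
  have h1 : (D.coreField (D.Ω₀ t) (D.toCore (D.R₀ t) (D.Ω₀ t) x)).1
      = (D.coreLinear (D.Ω₀ t) (D.toCore (D.R₀ t) (D.Ω₀ t) x)).1
        + D.attitudeRemainder 1 (D.toCore (D.R₀ t) (D.Ω₀ t) x) := rfl
  have hg : gain₁ D.J D.M₁ D.Ω₀ t = -hat (D.Ω₀ t) + D.innovationGain (D.Ω₀ t) := by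
    simp only [gain₁, innovationGain]; abel
  rw [h, h1, skewVec_add, skewVec_coreLinear, hg]
  obtain ⟨X, v, z₁, z₂⟩ := x
  simp only [coreField, coreLinear, coreRemainder, toCore, Prod.snd_add, Prod.fst_add,
    Matrix.add_mulVec, Matrix.mulVec_sub, Matrix.neg_mulVec]
  abel

/-- Ω̂₀ cancels in G = Ω̂₀ + L₁, M₁ is constant, and V is linear in the velocity. -/
theorem Design.derivWithin_gain₁ (D : Design) (href : IsReference D.J D.R₀ D.Ω₀ D.u₀) {t : ℝ}
    (ht : 0 ≤ t) :
    hat (derivWithin D.Ω₀ (Ici 0) t) + derivWithin (gain₁ D.J D.M₁ D.Ω₀) (Ici 0) t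
      = velocityBlock D.J (derivWithin D.Ω₀ (Ici 0) t) := by
  have hu : UniqueDiffWithinAt ℝ (Ici (0 : ℝ)) t := uniqueDiffOn_Ici 0 t ht
  have hΩ := (href.velocity t ht).differentiableWithinAt.hasDerivWithinAt
  have h : HasDerivWithinAt (gain₁ D.J D.M₁ D.Ω₀)
      (-hat (derivWithin D.Ω₀ (Ici 0) t) + velocityBlock D.J (derivWithin D.Ω₀ (Ici 0) t))
      (Ici 0) t :=
    ((hasDerivWithinAt_hat hΩ).neg.add (hasDerivWithinAt_velocityBlock D.J hΩ)).add_const _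
  refine (congrArg (hat (derivWithin D.Ω₀ (Ici 0) t) + ·) (h.derivWithin hu)).trans ?_
  exact add_neg_cancel_left _ _

/-- This is where L₂ is used. The coefficient of e in w' is V G - L₂ - G'. Since V = G - M₁ and L₂ =
-G' + G² - M₁ G + M₂, it equals -M₂; the coefficient of w is V - G = -M₁. The last bracket on the
right is the derivative of G e by the product rule. -/
theorem Design.observer_coreField_snd (D : Design) (href : IsReference D.J D.R₀ D.Ω₀ D.u₀)
    {t : ℝ} (ht : 0 ≤ t) (x : Mat3 × Vec3 × (Vec3 × Vec3)) :
    (D.coreField (D.Ω₀ t) (D.toCore (D.R₀ t) (D.Ω₀ t) x)).2.2.2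
      = (D.errorField t x).2.2.2 - (D.errorField t x).2.1
        - (D.innovationGain (D.Ω₀ t)
            *ᵥ (D.coreField (D.Ω₀ t) (D.toCore (D.R₀ t) (D.Ω₀ t) x)).2.2.1
          + velocityBlock D.J (derivWithin D.Ω₀ (Ici 0) t)
            *ᵥ (D.toCore (D.R₀ t) (D.Ω₀ t) x).2.2.1) := by
  have h : (D.errorField t x).2.1
      = eulerField D.J (D.Ω₀ t + x.2.1) (D.control t x.2.2)
        - eulerField D.J (D.Ω₀ t) (D.u₀ t) := rfl
  have h' : (D.errorField t x).2.2.2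
      = velocityBlock D.J (D.Ω₀ t) *ᵥ x.2.2.2 + D.J⁻¹ *ᵥ (D.control t x.2.2 - D.u₀ t)
        - gain₂ D.J D.M₁ D.M₂ D.Ω₀ t *ᵥ (x.2.2.1 - skewVec ((D.R₀ t)ᵀ * x.1)) := rfl
  have hg : hat (D.Ω₀ t) + gain₁ D.J D.M₁ D.Ω₀ t = D.innovationGain (D.Ω₀ t) := by
    simp only [gain₁, innovationGain]; abel
  have hv : velocityBlock D.J (D.Ω₀ t) = D.innovationGain (D.Ω₀ t) - D.M₁ := by
    simp only [innovationGain]; abel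
  rw [h, h', eulerField_sub, gain₂, hg, D.derivWithin_gain₁ href ht, hv]
  obtain ⟨X, v, z₁, z₂⟩ := x
  simp only [coreField, coreLinear, coreRemainder, toCore, Prod.snd_add, Prod.fst_add]
  generalize z₁ - skewVec ((D.R₀ t)ᵀ * X) = e
  simp only [pow_two, Matrix.add_mulVec, Matrix.sub_mulVec, Matrix.mulVec_sub, Matrix.mulVec_add,
    Matrix.neg_mulVec, Matrix.mulVec_neg, ← Matrix.mulVec_mulVec]
  abel

/-! ### Transfer of stability to the original error variables -/

theorem IsReference.mul_transpose {J : Mat3} {R₀ : ℝ → Mat3} {Ω₀ u₀ : ℝ → Vec3}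
    (href : IsReference J R₀ Ω₀ u₀) {t : ℝ} (ht : 0 ≤ t) : R₀ t * (R₀ t)ᵀ = 1 :=
  mul_eq_one_comm.1 (href.mem_SO3 t ht).1

theorem Design.errorField_zero (D : Design) (t : ℝ) : D.errorField t 0 = 0 := by
  have h : skewVec 0 = 0 := map_zero skewVecL
  change (attitudeField D.ke (D.R₀ t + 0) (D.Ω₀ t + 0) - attitudeField D.ke (D.R₀ t) (D.Ω₀ t),
    eulerField D.J (D.Ω₀ t + 0) (D.control t 0) - eulerField D.J (D.Ω₀ t) (D.u₀ t),
    D.observerField t 0 (D.control t 0 - D.u₀ t) (skewVec ((D.R₀ t)ᵀ * 0))) = 0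
  have hc : D.control t 0 = D.u₀ t := by simp [control]
  simp [hc, h, observerField]

theorem Design.isExpStable_errorField (D : Design)
    (hJ : D.J.PosDef) (hke : 0 < D.ke) (href : IsReference D.J D.R₀ D.Ω₀ D.u₀)
    (hkP : 0 < D.kP) (hKD : D.KD.PosDef) (hM₁ : D.M₁.PosDef) (hM₂ : D.M₂.PosDef) :
    IsExpStable D.errorField := by
  have hJJ : D.J⁻¹ * D.J = 1 := Matrix.nonsing_inv_mul _ ((Matrix.isUnit_iff_isUnit_det _).1 hJ.isUnit)
  have hcore := D.isExpStable_coreField hke hkP hKD hM₁ hM₂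
    (fun t ht => (href.velocity t ht).continuousWithinAt) href.bounded_velocity
  obtain ⟨C, hC⟩ := href.bounded_velocity
  obtain ⟨K₁, hK₁⟩ := D.exists_norm_toCore_le C
  obtain ⟨K₂, hK₂⟩ := D.exists_norm_ofCore_le C
  have hRn : ∀ t, 0 ≤ t → ‖D.R₀ t‖ ≤ 3 := fun t ht =>
    norm_le_three_of_transpose_mul_self (href.mem_SO3 t ht).1
  refine hcore.of_coordinates (fun t _ => D.errorField_zero t)
    (Φ := fun t => D.toCore (D.R₀ t) (D.Ω₀ t)) (Ψ := fun t => D.ofCore (D.R₀ t) (D.Ω₀ t))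
    (C := max K₁ K₂)
    (fun t ht => D.ofCore_toCore (href.mul_transpose ht) _)
    (fun t ht x => (hK₁ _ _ (hRn t ht) (hC t ht) x).trans
      (mul_le_mul_of_nonneg_right (le_max_left _ _) (norm_nonneg _)))
    (fun t ht x => (hK₂ _ _ (hRn t ht) (hC t ht) x).trans
      (mul_le_mul_of_nonneg_right (le_max_right _ _) (norm_nonneg _)))
    (fun s hs x t ht hx => ?_) (fun s hs y t ht hy => ?_)
  · have ht0 : 0 ≤ t := hs ht
    have hR := (href.attitude t ht0).mono hs
    have hΩ := (href.velocity t ht0).differentiableWithinAt.hasDerivWithinAt.mono hs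
    have hG := (hasDerivWithinAt_velocityBlock D.J hΩ).add_const D.M₁
    have hx1 := hasDerivWithinAt_snd hx
    have hx2 := hasDerivWithinAt_snd hx1
    have hxv := hasDerivWithinAt_fst hx1
    have hZ := hasDerivWithinAt_matrix_mul (hasDerivWithinAt_matrix_transpose hR)
      (hasDerivWithinAt_fst hx)
    have hZ' : HasDerivWithinAt (fun τ => (D.R₀ τ)ᵀ * (x τ).1)
        (D.coreField (D.Ω₀ t) (D.toCore (D.R₀ t) (D.Ω₀ t) (x t))).1 s t := by
      rw [D.attitude_coreField (href.mem_SO3 t ht0).1 (href.mul_transpose ht0)]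
      exact hZ
    have hv : HasDerivWithinAt (fun τ => (x τ).2.1)
        (D.coreField (D.Ω₀ t) (D.toCore (D.R₀ t) (D.Ω₀ t) (x t))).2.1 s t := by
      rw [D.velocity_coreField hJJ]
      exact hxv
    have he : HasDerivWithinAt (fun τ => (x τ).2.2.1 - skewVec ((D.R₀ τ)ᵀ * (x τ).1))
        (D.coreField (D.Ω₀ t) (D.toCore (D.R₀ t) (D.Ω₀ t) (x t))).2.2.1 s t := by
      rw [D.observer_coreField_fst]
      exact (hasDerivWithinAt_fst hx2).sub (hasDerivWithinAt_skewVec hZ')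
    have hw : HasDerivWithinAt
        (fun τ => (x τ).2.2.2 - (x τ).2.1
          - D.innovationGain (D.Ω₀ τ) *ᵥ ((x τ).2.2.1 - skewVec ((D.R₀ τ)ᵀ * (x τ).1)))
        (D.coreField (D.Ω₀ t) (D.toCore (D.R₀ t) (D.Ω₀ t) (x t))).2.2.2 s t := by
      rw [D.observer_coreField_snd href ht0]
      exact ((hasDerivWithinAt_snd hx2).sub hxv).sub (hasDerivWithinAt_matrix_mulVec hG he)
    exact hZ'.prodMk (hv.prodMk (he.prodMk hw))
  · have ht0 : 0 ≤ t := hs ht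
    have hR := (href.attitude t ht0).mono hs
    have hΩ := (href.velocity t ht0).differentiableWithinAt.hasDerivWithinAt.mono hs
    have hG := (hasDerivWithinAt_velocityBlock D.J hΩ).add_const D.M₁
    have hy1 := hasDerivWithinAt_fst hy
    have hyv := hasDerivWithinAt_fst (hasDerivWithinAt_snd hy)
    have hy2 := hasDerivWithinAt_snd (hasDerivWithinAt_snd hy)
    have hye := hasDerivWithinAt_fst hy2
    have hRR := href.mul_transpose ht0
    -- The component identities are stated at `toCore` of a state. Writing y t in that form lets
    -- them be solved for the components of `errorField`, so the inverse change needs no separate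
    -- computation.
    obtain ⟨x, hxy⟩ : ∃ x, x = D.ofCore (D.R₀ t) (D.Ω₀ t) (y t) := ⟨_, rfl⟩
    have hyx : y t = D.toCore (D.R₀ t) (D.Ω₀ t) x := by
      rw [hxy, D.toCore_ofCore (href.mem_SO3 t ht0).1]
    have hX : x.1 = D.R₀ t * (y t).1 := by rw [hxy]; rfl
    have k1 := D.attitude_coreField (href.mem_SO3 t ht0).1 hRR (D.Ω₀ t) x
    have k2 := D.velocity_coreField hJJ t x
    have k3 := D.observer_coreField_fst t x
    have k4 := D.observer_coreField_snd href ht0 x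
    rw [← hyx] at k1 k2 k3 k4
    rw [← hxy]
    have f1 : D.R₀ t * (D.coreField (D.Ω₀ t) (y t)).1 + D.R₀ t * hat (D.Ω₀ t) * (y t).1
        = (D.errorField t x).1 := by
      rw [k1, hX, Matrix.transpose_mul, transpose_hat, mul_add, ← mul_assoc (D.R₀ t) (D.R₀ t)ᵀ,
        hRR, one_mul, mul_assoc (-hat (D.Ω₀ t)), ← mul_assoc (D.R₀ t)ᵀ (D.R₀ t),
        (href.mem_SO3 t ht0).1, one_mul, neg_mul, mul_neg, mul_assoc, neg_add_cancel_right, ← hX]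
      rfl
    have f3 : (D.coreField (D.Ω₀ t) (y t)).2.2.1 + skewVec (D.coreField (D.Ω₀ t) (y t)).1
        = (D.errorField t x).2.2.1 := by rw [k3, sub_add_cancel]
    have f4 : (D.coreField (D.Ω₀ t) (y t)).2.2.2 + (D.coreField (D.Ω₀ t) (y t)).2.1
        + (D.innovationGain (D.Ω₀ t) *ᵥ (D.coreField (D.Ω₀ t) (y t)).2.2.1
          + velocityBlock D.J (derivWithin D.Ω₀ (Ici 0) t) *ᵥ (y t).2.2.1)
        = (D.errorField t x).2.2.2 := by rw [k4, k2]; abel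
    have g1 : HasDerivWithinAt (fun τ => D.R₀ τ * (y τ).1) (D.errorField t x).1 s t := by
      rw [← f1]; exact hasDerivWithinAt_matrix_mul hR hy1
    have g2 : HasDerivWithinAt (fun τ => (y τ).2.1) (D.errorField t x).2.1 s t := by
      rw [← k2]; exact hyv
    have g3 : HasDerivWithinAt (fun τ => (y τ).2.2.1 + skewVec (y τ).1)
        (D.errorField t x).2.2.1 s t := by
      rw [← f3]; exact hye.add (hasDerivWithinAt_skewVec hy1)
    have g4 : HasDerivWithinAt
        (fun τ => (y τ).2.2.2 + (y τ).2.1 + D.innovationGain (D.Ω₀ τ) *ᵥ (y τ).2.2.1)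
        (D.errorField t x).2.2.2 s t := by
      rw [← f4]
      exact ((hasDerivWithinAt_snd hy2).add hyv).add (hasDerivWithinAt_matrix_mulVec hG hye)
    exact g1.prodMk (g2.prodMk (g3.prodMk g4))

/-! ### Passage to the symmetric and skew parts of the attitude error -/

/-- The state `(ΔR, ΔΩ, z)` with coordinates `(Z_s, Z_k^∨, ΔΩ, z)`, at the reference attitude. -/
def ofSymSkew (R : Mat3) (x : SymMat3 × Vec3 × Vec3 × (Vec3 × Vec3)) :
    Mat3 × Vec3 × (Vec3 × Vec3) :=
  (R * ((x.1 : Mat3) + hat x.2.1), x.2.2)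

/-- The coordinates `(Z_s, Z_k^∨, ΔΩ, z)` of the state `(ΔR, ΔΩ, z)`, at the reference attitude. -/
def toSymSkew (R : Mat3) (x : Mat3 × Vec3 × (Vec3 × Vec3)) :
    SymMat3 × Vec3 × Vec3 × (Vec3 × Vec3) :=
  (symPart (Rᵀ * x.1), skewVec (Rᵀ * x.1), x.2)

theorem exists_norm_ofSymSkew_le :
    ∃ K : ℝ, ∀ R, ‖R‖ ≤ 3 → ∀ x, ‖ofSymSkew R x‖ ≤ K * ‖x‖ := by
  refine exists_norm_le_of_homogeneous (H := ofSymSkew) ?_ (fun R c x => ?_) 3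
  · have h : ContDiff ℝ 1 fun q : Mat3 × SymMat3 × Vec3 × Vec3 × (Vec3 × Vec3) =>
        (q.2.1 : Mat3) :=
      SymMat3.subtypeL.contDiff.comp (contDiff_fst.comp contDiff_snd)
    unfold ofSymSkew
    fun_prop
  · simp only [ofSymSkew, Prod.smul_fst, Prod.smul_snd, Submodule.coe_smul, hat_smul, ← smul_add,
      mul_smul_comm, Prod.smul_mk]

theorem exists_norm_toSymSkew_le :
    ∃ K : ℝ, ∀ R, ‖R‖ ≤ 3 → ∀ x, ‖toSymSkew R x‖ ≤ K * ‖x‖ := by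
  refine exists_norm_le_of_homogeneous (H := toSymSkew) ?_ (fun R c x => ?_) 3
  · have h : ContDiff ℝ 1 fun q : Mat3 × Mat3 × Vec3 × (Vec3 × Vec3) =>
        symPart (q.1ᵀ * q.2.1) := symPartL.contDiff.comp (by fun_prop)
    unfold toSymSkew
    fun_prop
  · simp only [toSymSkew, Prod.smul_fst, Prod.smul_snd, mul_smul_comm, symPart_smul, skewVec_smul,
      Prod.smul_mk]

/-- `errorFieldZ` is `errorField` seen through ΔR = R₀ (Z_s + Z_k), a linear change of variables
bounded in both directions because R₀ is orthogonal. -/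
theorem Design.isExpStable_errorFieldZ (D : Design) (href : IsReference D.J D.R₀ D.Ω₀ D.u₀)
    (h : IsExpStable D.errorField) : IsExpStable D.errorFieldZ := by
  obtain ⟨K₁, hK₁⟩ := exists_norm_ofSymSkew_le
  obtain ⟨K₂, hK₂⟩ := exists_norm_toSymSkew_le
  have hRn : ∀ t, 0 ≤ t → ‖D.R₀ t‖ ≤ 3 := fun t ht =>
    norm_le_three_of_transpose_mul_self (href.mem_SO3 t ht).1
  have hfield : ∀ t x, D.errorFieldZ t x
      = (symPart ((D.R₀ t)ᵀ * (D.errorField t (ofSymSkew (D.R₀ t) x)).1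
            + (D.R₀ t * hat (D.Ω₀ t))ᵀ * (ofSymSkew (D.R₀ t) x).1),
         skewVec ((D.R₀ t)ᵀ * (D.errorField t (ofSymSkew (D.R₀ t) x)).1
            + (D.R₀ t * hat (D.Ω₀ t))ᵀ * (ofSymSkew (D.R₀ t) x).1),
         (D.errorField t (ofSymSkew (D.R₀ t) x)).2) := fun t x => by
    rw [add_comm]; rfl
  refine h.of_coordinates (fun t _ => ?_) (Φ := fun t => ofSymSkew (D.R₀ t))
    (Ψ := fun t => toSymSkew (D.R₀ t)) (C := max K₁ K₂) (fun t ht x => ?_)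
    (fun t ht x => (hK₁ _ (hRn t ht) x).trans
      (mul_le_mul_of_nonneg_right (le_max_left _ _) (norm_nonneg _)))
    (fun t ht x => (hK₂ _ (hRn t ht) x).trans
      (mul_le_mul_of_nonneg_right (le_max_right _ _) (norm_nonneg _)))
    (fun s hs x t ht hx => ?_) (fun s hs y t ht hy => ?_)
  · have h1 : ofSymSkew (D.R₀ t) 0 = 0 := by
      have h0 : hat 0 = 0 := map_zero hatL
      simp [ofSymSkew, h0]
    have h2 : symPart 0 = 0 := map_zero symPartL
    have h3 : skewVec 0 = 0 := map_zero skewVecL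
    rw [hfield, h1, D.errorField_zero]
    simp [h2, h3]
  · simp only [toSymSkew, ofSymSkew, ← mul_assoc, (href.mem_SO3 t ht).1, one_mul,
      symPart_coe_add_hat, skewVec_coe_add_hat]
  · have ht0 : 0 ≤ t := hs ht
    have hR := (href.attitude t ht0).mono hs
    have hRR := href.mul_transpose ht0
    rw [hfield] at hx
    have hW := (hasDerivWithinAt_symMat3_coe (hasDerivWithinAt_fst hx)).add
      (hasDerivWithinAt_hat (hasDerivWithinAt_fst (hasDerivWithinAt_snd hx)))
    rw [symPart_add_hat_skewVec] at hW
    -- In the product rule, R₀ Ω̂₀ Z from the derivative of R₀ cancels the -Ω̂₀ Z in Z', leaving the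
    -- field of ΔR.
    have h1 := hasDerivWithinAt_matrix_mul hR hW
    have f1 : D.R₀ t * ((D.R₀ t)ᵀ * (D.errorField t (ofSymSkew (D.R₀ t) (x t))).1
          + (D.R₀ t * hat (D.Ω₀ t))ᵀ * (ofSymSkew (D.R₀ t) (x t)).1)
        + D.R₀ t * hat (D.Ω₀ t) * (((x t).1 : Mat3) + hat (x t).2.1)
        = (D.errorField t (ofSymSkew (D.R₀ t) (x t))).1 := by
      have hX : (ofSymSkew (D.R₀ t) (x t)).1
          = D.R₀ t * (((x t).1 : Mat3) + hat (x t).2.1) := rfl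
      rw [hX, Matrix.transpose_mul, transpose_hat, mul_add, ← mul_assoc (D.R₀ t) (D.R₀ t)ᵀ,
        hRR, one_mul, mul_assoc (-hat (D.Ω₀ t)), ← mul_assoc (D.R₀ t)ᵀ (D.R₀ t),
        (href.mem_SO3 t ht0).1, one_mul, neg_mul, mul_neg, mul_assoc (D.R₀ t) (hat (D.Ω₀ t)),
        neg_add_cancel_right]
    have g1 : HasDerivWithinAt (fun τ => D.R₀ τ * (((x τ).1 : Mat3) + hat (x τ).2.1))
        (D.errorField t (ofSymSkew (D.R₀ t) (x t))).1 s t := by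
      rw [← f1]; exact h1
    exact g1.prodMk (hasDerivWithinAt_snd (hasDerivWithinAt_snd hx))
  · have ht0 : 0 ≤ t := hs ht
    have hR := (href.attitude t ht0).mono hs
    have hy' : ofSymSkew (D.R₀ t) (toSymSkew (D.R₀ t) (y t)) = y t := by
      simp only [toSymSkew, ofSymSkew, symPart_add_hat_skewVec, ← mul_assoc,
        href.mul_transpose ht0, one_mul]
    rw [hfield, hy']
    have hZ := hasDerivWithinAt_matrix_mul (hasDerivWithinAt_matrix_transpose hR)
      (hasDerivWithinAt_fst hy)
    exact (hasDerivWithinAt_symPart hZ).prodMk ((hasDerivWithinAt_skewVec hZ).prodMk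
      (hasDerivWithinAt_snd hy))

end RigidBody

end

theorem mainTheorem8 (D : RigidBody.Design)
    (hJ : D.J.PosDef) (hke : 0 < D.ke)
    (href : RigidBody.IsReference D.J D.R₀ D.Ω₀ D.u₀)
    (hkP : 0 < D.kP) (hKD : D.KD.PosDef)
    (hM₁ : D.M₁.PosDef) (hM₂ : D.M₂.PosDef) :
    RigidBody.IsExpStable D.errorField ∧ RigidBody.IsExpStable D.errorFieldZ := by
  have h := D.isExpStable_errorField hJ hke href hkP hKD hM₁ hM₂
  exact ⟨h, D.isExpStable_errorFieldZ href h⟩
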